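/- Consider the system $x(k+1)=Ax(k)+w(k)$, $x(0)=x_0$, $y(k)=Cx(k)+v(k)$, with $A\in\mathbb R^{n\times n}$, $C\in\mathbb R^{m\times n}$, where $w$ and $v$ are mutually independent (wide-sense) white noises with mean zero and covariances $Q\ge 0$ and $R>0$, $R$ diagonal, and where $x_0$ has mean $\bar x_0$ and covariance $\Pi_0$ and is independent of $(w,v)$. The $m$ measurements are sent over $m$ packet drop channels: the estimator receives $y_{\rm r}(k)=\Gamma(k)y(k)$, $\Gamma(k)=\mathrm{diag}\{\gamma_1(k),\dots,\gamma_m(k)\}$, where $\gamma_1,\dots,\gamma_m$ are mutually independent time-homogeneous Markov chains on $\{0,1\}$, jointly independent of $(x_0,w,v)$, with recovery rates $q_l=\Pr\{\gamma_l(k+1)=1\mid\gamma_l(k)=0\}\in(0,1)$ and failure rates $p_l=\Pr\{\gamma_l(k+1)=0\mid\gamma_l(k)=1\}\in(0,1)$. Let $\theta(k)=1+\sum_{l=1}^m2^{l-1}\gamma_l(k)\in\{1,\dots,N\}$, $N=2^m$, be the mode. It is a Markov chain; let $p_{ij}$ be its transition probabilities (products of those of the channels) and $\mu_i$ its stationary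 distribution (the product of the stationary distributions $\left(\frac{p_l}{p_l+q_l},\frac{q_l}{p_l+q_l}\right)$ of the channels on $(0,1)$). For mode $i$ let $D_i$ be the corresponding value of $\Gamma$, and $H_i=D_iC$. For gains $L=(L_1,\dots,L_N)$, $L_i\in\mathbb R^{n\times m}$, and an initial estimate $\hat x(0)\in\mathbb R^n$, the jump estimator is $\hat x(k+1)=A\hat x(k)+L_{\theta(k)}[y_{\rm r}(k)-H_{\theta(k)}\hat x(k)]$, with cost $J_L(k)=\mathrm E\,\|x(k)-\hat x(k)\|^2$. The gains $L$ are called mean-square (MS) stable if the operator $V\mapsto\big(\sum_{i}p_{ij}(A-L_iH_i)V_i(A-L_iH_i)'\big)_{j}$ on $N$-tuples of $n\times n$ matrices has spectral radius less than $1$. Assume that the coupled algebraic Riccati equations (CAREs) $$Y_j=\sum_{i=1}^Np_{ij}\big[AY_iA'-AY_iH_i'(H_iY_iH_i'+\mu_iR)^{-1}H_iY_iA'+\mu_iQ\big],\qquad j=1,\dots,N,$$ have an MS stabilizing solution $Y=(Y_1,\dots,Y_N)$, that is, a solution with all $Y_i\ge0$ for which the gains $$K_j=AY_jH_j'(H_jY_jH_j'+\mu_jR)^{-1},\qquad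 j=1,\dots,N,$$ are MS stable. Then the gains $K_j$ are optimal stationary gains of the jump estimator, and the optimal stationary cost is $\sum_{i}\mathrm{tr}(Y_i)$. Precisely: 1. for every $\hat x(0)\in\mathbb R^n$, $\lim_{k\to\infty}J_K(k)=\sum_{i=1}^N\mathrm{tr}(Y_i)$; 2. for all MS stable gains $L$ and every $\hat x(0)\in\mathbb R^n$, $\liminf_{k\to\infty}J_L(k)\ge\sum_{i=1}^N\mathrm{tr}(Y_i)$; 3. if $\Pi_0$ is positive definite, then the inequality in 2 holds for all gains $L$, MS stable or not, and every $\hat x(0)\in\mathbb R^n$. -/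

import Mathlib

open Filter Topology MeasureTheory ProbabilityTheory
open scoped Matrix ENNReal

namespace PacketDrop

/-- The mode of the jump system: the arrival pattern of the `m` channels, `true` meaning that the
packet arrives (`γ = 1`) and `false` that it is dropped (`γ = 0`). There are `N = 2 ^ m` modes; the
pattern `γ` carries the label `1 + ∑ i, 2 ^ (i - 1) * γ i`. -/
abbrev Mode (m : ℕ) : Type := Fin m → Bool

/-- Transition probabilities of one channel with failure rate `p` and recovery rate `q`. -/
def tpm (p q : ℝ) : Bool → Bool → ℝ
  | false, false => 1 - q
  | false, true => q
  | true, false => p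
  | true, true => 1 - p

/-- Limit distribution of one channel with failure rate `p` and recovery rate `q`. -/
noncomputable def limitProb (p q : ℝ) : Bool → ℝ
  | false => p / (p + q)
  | true => q / (p + q)

/-- The transition probabilities `p_{ij}` of the mode: the entries of the Kronecker product of the
transition matrices of the channels. -/
def modeTPM {m : ℕ} (p q : Fin m → ℝ) (i j : Mode m) : ℝ :=
  ∏ l, tpm (p l) (q l) (i l) (j l)

/-- The stationary distribution `μ_i` of the mode: the entries of the Kronecker product of the
limit distributions of the channels. -/
noncomputable def modeProb {m : ℕ} (p q : Fin m → ℝ) (i : Mode m) : ℝ :=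
  ∏ l, limitProb (p l) (q l) (i l)

/-- `D_i = diag {γ_1, …, γ_m}` for the mode `i = (γ_1, …, γ_m)`. -/
def dropMat {m : ℕ} (i : Mode m) : Matrix (Fin m) (Fin m) ℝ :=
  Matrix.diagonal fun l => if i l = true then 1 else 0

/-- `H_i = D_i C`. -/
def obsMat {n m : ℕ} (C : Matrix (Fin m) (Fin n) ℝ) (i : Mode m) : Matrix (Fin m) (Fin n) ℝ :=
  dropMat i * C

/-- The operator `V ↦ (∑ i, p_{ij} (A + L_i H_i) V_i (A + L_i H_i)')_j` on families of real
matrices indexed by the modes. -/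
noncomputable def gainOp {n m : ℕ} (A : Matrix (Fin n) (Fin n) ℝ) (C : Matrix (Fin m) (Fin n) ℝ)
    (p q : Fin m → ℝ) (L : Mode m → Matrix (Fin n) (Fin m) ℝ) :
    (Mode m → Matrix (Fin n) (Fin n) ℝ) →ₗ[ℝ] (Mode m → Matrix (Fin n) (Fin n) ℝ) where
  toFun V j := ∑ i, modeTPM p q i j •
    ((A + L i * obsMat C i) * V i * (A + L i * obsMat C i)ᵀ)
  map_add' V W := by
    funext j
    simp only [Pi.add_apply, Matrix.mul_add, Matrix.add_mul, smul_add, Finset.sum_add_distrib]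
  map_smul' c V := by
    funext j
    simp only [Pi.smul_apply, Matrix.mul_smul, Matrix.smul_mul, RingHom.id_apply, Finset.smul_sum]
    exact Finset.sum_congr rfl fun i _ => smul_comm _ _ _

/-- The spectral radius of an endomorphism of a real vector space, that is, the spectral radius of
its complexification. -/
noncomputable def realSpectralRadius {E : Type*} [AddCommGroup E] [Module ℝ E]
    (T : E →ₗ[ℝ] E) : ℝ≥0∞ :=
  spectralRadius ℂ (T.baseChange ℂ : Module.End ℂ (TensorProduct ℝ ℂ E))

/-- The gains `L` of the jump estimator make its error dynamics, whose system matrix is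
`A - L_i H_i` in mode `i`, mean-square stable. -/
def IsMSStable {n m : ℕ} (A : Matrix (Fin n) (Fin n) ℝ) (C : Matrix (Fin m) (Fin n) ℝ)
    (p q : Fin m → ℝ) (L : Mode m → Matrix (Fin n) (Fin m) ℝ) : Prop :=
  realSpectralRadius (gainOp A C p q (fun i => -L i)) < 1

/-- The matrix `H_i Y_i H_i' + μ_i R`. -/
noncomputable def innovMat {n m : ℕ} (C : Matrix (Fin m) (Fin n) ℝ) (R : Matrix (Fin m) (Fin m) ℝ)
    (p q : Fin m → ℝ) (Y : Mode m → Matrix (Fin n) (Fin n) ℝ) (i : Mode m) :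
    Matrix (Fin m) (Fin m) ℝ :=
  obsMat C i * Y i * (obsMat C i)ᵀ + modeProb p q i • R

/-- The gain `K_i(Y) = A Y_i H_i' (H_i Y_i H_i' + μ_i R)⁻¹`. -/
noncomputable def kalmanGain {n m : ℕ} (A : Matrix (Fin n) (Fin n) ℝ)
    (C : Matrix (Fin m) (Fin n) ℝ) (R : Matrix (Fin m) (Fin m) ℝ) (p q : Fin m → ℝ)
    (Y : Mode m → Matrix (Fin n) (Fin n) ℝ) (i : Mode m) : Matrix (Fin n) (Fin m) ℝ :=
  A * Y i * (obsMat C i)ᵀ * (innovMat C R p q Y i)⁻¹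

/-- The coupled algebraic Riccati equations. -/
def SolvesCARE {n m : ℕ} (A : Matrix (Fin n) (Fin n) ℝ) (C : Matrix (Fin m) (Fin n) ℝ)
    (Q : Matrix (Fin n) (Fin n) ℝ) (R : Matrix (Fin m) (Fin m) ℝ) (p q : Fin m → ℝ)
    (Y : Mode m → Matrix (Fin n) (Fin n) ℝ) : Prop :=
  ∀ j, Y j = ∑ i, modeTPM p q i j •
    (A * Y i * Aᵀ
      - A * Y i * (obsMat C i)ᵀ * (innovMat C R p q Y i)⁻¹ * obsMat C i * Y i * Aᵀ
      + modeProb p q i • Q)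

/-- Mean-square stabilizing solutions of the coupled algebraic Riccati equations. -/
structure IsMSStabilizingSolution {n m : ℕ} (A : Matrix (Fin n) (Fin n) ℝ)
    (C : Matrix (Fin m) (Fin n) ℝ) (Q : Matrix (Fin n) (Fin n) ℝ) (R : Matrix (Fin m) (Fin m) ℝ)
    (p q : Fin m → ℝ) (Y : Mode m → Matrix (Fin n) (Fin n) ℝ) : Prop where
  posSemidef : ∀ i, (Y i).PosSemidef
  care : SolvesCARE A C Q R p q Y
  stable : IsMSStable A C p q (kalmanGain A C R p q Y)

/-- `X` is a time-homogeneous Markov chain on `S` with transition probabilities `T`: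
`Pr (X_0 = a_0, …, X_{k+1} = a_{k+1}) = Pr (X_0 = a_0, …, X_k = a_k) * T a_k a_{k+1}`. -/
def IsMarkovChain {Ω S : Type*} [MeasurableSpace Ω] (P : Measure Ω) (X : ℕ → Ω → S)
    (T : S → S → ℝ) : Prop :=
  ∀ (k : ℕ) (a : ℕ → S), P {ω | ∀ l ≤ k + 1, X l ω = a l} =
    P {ω | ∀ l ≤ k, X l ω = a l} * ENNReal.ofReal (T (a k) (a (k + 1)))

/-- `u` is a (wide-sense) white noise with mean zero and covariance matrix `S`. -/
structure IsWhiteNoise {Ω : Type*} [MeasurableSpace Ω] (P : Measure Ω) {d : ℕ}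
    (u : ℕ → Ω → Fin d → ℝ) (S : Matrix (Fin d) (Fin d) ℝ) : Prop where
  measurable : ∀ k, Measurable (u k)
  memLp : ∀ k a, MemLp (fun ω => u k ω a) 2 P
  mean : ∀ k a, ∫ ω, u k ω a ∂P = 0
  covariance : ∀ k l a b, ∫ ω, u k ω a * u l ω b ∂P = if k = l then S a b else 0

/-- The stochastic assumptions on the initial state `x₀`, the process noise `w`, the measurement
noise `v` and the channel states `γ i k` (channel `i`, time `k`). -/
structure IsPacketDropModel {Ω : Type*} [MeasurableSpace Ω] (P : Measure Ω) {n m : ℕ}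
    (Q : Matrix (Fin n) (Fin n) ℝ) (R : Matrix (Fin m) (Fin m) ℝ) (p q : Fin m → ℝ)
    (xbar : Fin n → ℝ) (Pi0 : Matrix (Fin n) (Fin n) ℝ)
    (x₀ : Ω → Fin n → ℝ) (w : ℕ → Ω → Fin n → ℝ) (v : ℕ → Ω → Fin m → ℝ)
    (γ : Fin m → ℕ → Ω → Bool) : Prop where
  noise_w : IsWhiteNoise P w Q
  noise_v : IsWhiteNoise P v R
  indep_noise : IndepFun (fun ω k => w k ω) (fun ω k => v k ω) P
  measurable_init : Measurable x₀
  memLp_init : ∀ a, MemLp (fun ω => x₀ ω a) 2 P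
  mean_init : ∀ a, ∫ ω, x₀ ω a ∂P = xbar a
  cov_init : ∀ a b, ∫ ω, (x₀ ω a - xbar a) * (x₀ ω b - xbar b) ∂P = Pi0 a b
  indep_init : IndepFun x₀ (fun ω => ((fun k => w k ω), (fun k => v k ω))) P
  measurable_channel : ∀ i k, Measurable (γ i k)
  markov : ∀ i, IsMarkovChain P (γ i) (tpm (p i) (q i))
  indep_channels : iIndepFun (fun i ω k => γ i k ω) P
  indep_channels_noise :
    IndepFun (fun ω i k => γ i k ω) (fun ω => (x₀ ω, (fun k => w k ω), (fun k => v k ω))) P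

/-- The state: `x(k+1) = A x(k) + w(k)`, `x(0) = x₀`. -/
def state {n : ℕ} (A : Matrix (Fin n) (Fin n) ℝ) (x₀ : Fin n → ℝ) (w : ℕ → Fin n → ℝ) :
    ℕ → Fin n → ℝ
  | 0 => x₀
  | k + 1 => A *ᵥ state A x₀ w k + w k

/-- The received signal `y_r(k) = Γ(k) (C x(k) + v(k))`, where `θ k` is the mode at time `k`. -/
def received {n m : ℕ} (C : Matrix (Fin m) (Fin n) ℝ) (θ : ℕ → Mode m) (x : ℕ → Fin n → ℝ)
    (v : ℕ → Fin m → ℝ) (k : ℕ) : Fin m → ℝ :=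
  dropMat (θ k) *ᵥ (C *ᵥ x k + v k)

/-- The jump estimator with gains `L`, started at `z₀`:
`z(k+1) = A z(k) + L_{θ(k)} (y_r(k) - H_{θ(k)} z(k))`. -/
def estimate {n m : ℕ} (A : Matrix (Fin n) (Fin n) ℝ) (C : Matrix (Fin m) (Fin n) ℝ)
    (L : Mode m → Matrix (Fin n) (Fin m) ℝ) (θ : ℕ → Mode m) (y : ℕ → Fin m → ℝ)
    (z₀ : Fin n → ℝ) : ℕ → Fin n → ℝ
  | 0 => z₀
  | k + 1 => A *ᵥ estimate A C L θ y z₀ k +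
      L (θ k) *ᵥ (y k - obsMat C (θ k) *ᵥ estimate A C L θ y z₀ k)

/-- The mean-square error `J(k) = E ‖x(k) - x̂(k)‖²` (Euclidean norm) of the jump estimator with
gains `L` and initial estimate `z₀`. -/
noncomputable def cost {Ω : Type*} [MeasurableSpace Ω] (P : Measure Ω) {n m : ℕ}
    (A : Matrix (Fin n) (Fin n) ℝ) (C : Matrix (Fin m) (Fin n) ℝ)
    (x₀ : Ω → Fin n → ℝ) (w : ℕ → Ω → Fin n → ℝ) (v : ℕ → Ω → Fin m → ℝ)
    (γ : Fin m → ℕ → Ω → Bool) (L : Mode m → Matrix (Fin n) (Fin m) ℝ) (z₀ : Fin n → ℝ)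
    (k : ℕ) : ℝ≥0∞ :=
  ∫⁻ ω,
    let θ : ℕ → Mode m := fun k i => γ i k ω
    let x : ℕ → Fin n → ℝ := state A (x₀ ω) (fun k => w k ω)
    let y : ℕ → Fin m → ℝ := received C θ x (fun k => v k ω)
    ENNReal.ofReal (‖WithLp.toLp 2 (x k - estimate A C L θ y z₀ k)‖ ^ 2) ∂P

end PacketDrop

/-!
Conditionally on the path of the mode, the estimation error is the state of a linear system driven
by uncorrelated noise. Averaging first over the noises and then over the Markov chain, the
mode-wise error covariances `X k` satisfy `X (k + 1) = T (X k) + B k` for a positive operator `T`,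
the operator whose spectral radius defines mean-square stability, and inputs `B k` converging to
the input `B` of the stationary mode. Completing the square in the Riccati equations gives
`Y + G = T Y + B` for every choice of gains, where `G ≥ 0` vanishes for the gains `K(Y)`. Since the
transition probabilities are positive, `B k` is eventually between `c B` and `c' B` for any
`c < 1 < c'`.

If the iterates of `T` decay, comparing the two recursions gives that the cost tends to `tr Y` when
`G = 0`, and that its lower limit is at least `tr Y` in general. For arbitrary gains, consider
`∑ tr (T ^ t G)`. If this sum is bounded, a Lyapunov function of the stable operator of `K(Y)`
shows that the iterates of `T` decay after all. If it is unbounded and the initial error covariance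
is positive definite, then `X 1` dominates a multiple of `Y`, and the cost grows at least like the
partial sums.
-/

namespace PacketDrop

section SpectralRadius

theorem eventually_nnnorm_pow_le {R : Type*} [NormedRing R] [NormedAlgebra ℂ R] [CompleteSpace R]
    {a : R} {s : NNReal} (ha : spectralRadius ℂ a < s) : ∀ᶠ k : ℕ in atTop, ‖a ^ k‖₊ ≤ s ^ k := by
  have hroot := spectrum.pow_nnnorm_pow_one_div_tendsto_nhds_spectralRadius a
  filter_upwards [hroot.eventually_le_const ha, eventually_gt_atTop 0] with k hk hk0
  have hpow := ENNReal.rpow_le_rpow hk (Nat.cast_nonneg k)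
  rw [← ENNReal.rpow_mul, one_div_mul_cancel (by positivity), ENNReal.rpow_one,
    ENNReal.rpow_natCast] at hpow
  exact_mod_cast hpow

theorem exists_tendsto_smul_pow_zero {R : Type*} [NormedRing R] [NormedAlgebra ℂ R]
    [CompleteSpace R] {a : R} (ha : spectralRadius ℂ a < 1) :
    ∃ r : ℝ, 1 < r ∧ Tendsto (fun k : ℕ => (r : ℂ) ^ k • a ^ k) atTop (𝓝 0) := by
  obtain ⟨s, has, hs⟩ := ENNReal.lt_iff_exists_nnreal_btwn.1 ha
  obtain ⟨r, hr, hrs⟩ : ∃ r : ℝ, 1 < r ∧ r * s < 1 := by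
    have hlim : Tendsto (fun r : ℝ => r * s) (𝓝[>] 1) (𝓝 (1 * s)) :=
      (tendsto_id.mul_const _).mono_left nhdsWithin_le_nhds
    have hs1 : 1 * (s : ℝ) < 1 := by rw [one_mul]; exact_mod_cast hs
    exact (eventually_mem_nhdsWithin.and (hlim.eventually_lt_const hs1)).exists
  refine ⟨r, hr, squeeze_zero_norm' ?_ (tendsto_pow_atTop_nhds_zero_of_lt_one (by positivity) hrs)⟩
  filter_upwards [eventually_nnnorm_pow_le has] with k hk
  rw [norm_smul, norm_pow, Complex.norm_real, Real.norm_of_nonneg (by positivity), mul_pow]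
  gcongr
  exact_mod_cast hk

open scoped Matrix.Norms.Operator in
theorem exists_tendsto_matrix_pow_zero {ι : Type*} [Fintype ι] [DecidableEq ι]
    {M : Matrix ι ι ℝ} (hM : spectralRadius ℂ (M.map (algebraMap ℝ ℂ)) < 1) :
    ∃ r : ℝ, 1 < r ∧ ∀ f : Matrix ι ι ℝ →ₗ[ℝ] ℝ,
      Tendsto (fun k : ℕ => r ^ k * f (M ^ k)) atTop (𝓝 0) := by
  obtain ⟨r, hr, hlim⟩ := exists_tendsto_smul_pow_zero hM
  let re : Matrix ι ι ℂ →ₗ[ℝ] Matrix ι ι ℝ := Complex.reLm.mapMatrix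
  have hre (k : ℕ) : re ((r : ℂ) ^ k • M.map (algebraMap ℝ ℂ) ^ k) = r ^ k • M ^ k := by
    have hpow : M.map (algebraMap ℝ ℂ) ^ k = (M ^ k).map (algebraMap ℝ ℂ) :=
      (map_pow (algebraMap ℝ ℂ).mapMatrix M k).symm
    rw [hpow]
    ext i j
    simp [re, ← Complex.ofReal_pow]
  refine ⟨r, hr, fun f => ?_⟩
  have hf := (LinearMap.continuous_of_finiteDimensional (f ∘ₗ re)).tendsto 0
  rw [map_zero] at hf
  exact (hf.comp hlim).congr fun k => by
    rw [Function.comp_apply, LinearMap.comp_apply, hre, map_smul, smul_eq_mul]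

theorem exists_tendsto_pow_apply_zero {E : Type*} [AddCommGroup E] [Module ℝ E] [Module.Finite ℝ E]
    {T : E →ₗ[ℝ] E} (hT : realSpectralRadius T < 1) :
    ∃ r : ℝ, 1 < r ∧ ∀ (f : E →ₗ[ℝ] ℝ) (x : E),
      Tendsto (fun k : ℕ => r ^ k * f ((T ^ k) x)) atTop (𝓝 0) := by
  let b := Module.finBasis ℝ E
  have hM : spectralRadius ℂ ((LinearMap.toMatrixAlgEquiv b T).map (algebraMap ℝ ℂ)) < 1 := by
    have hbase : (LinearMap.toMatrixAlgEquiv b T).map (algebraMap ℝ ℂ) =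
        LinearMap.toMatrixAlgEquiv (Algebra.TensorProduct.basis ℂ b)
          (T.baseChange ℂ : Module.End ℂ (TensorProduct ℝ ℂ E)) :=
      (LinearMap.toMatrix_baseChange ℂ T b b).symm
    rwa [hbase, spectralRadius, AlgEquiv.spectrum_eq]
  obtain ⟨r, hr, hlim⟩ := exists_tendsto_matrix_pow_zero hM
  refine ⟨r, hr, fun f x => ?_⟩
  refine (hlim (f ∘ₗ LinearMap.applyₗ x ∘ₗ (Matrix.toLinAlgEquiv b).toLinearMap)).congr fun k => ?_
  simp [← map_pow]

end SpectralRadius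

section OrderedDynamics

variable {E : Type*} [AddCommGroup E] [Module ℝ E] {T : E →ₗ[ℝ] E} {Y B G : E}

theorem iterate_affine_of_add_eq (hY : Y + G = T Y + B) (c : ℝ) (x : E) (t : ℕ) :
    (fun z => T z + c • B)^[t] x =
      c • (Y + ∑ i ∈ Finset.range t, (T ^ i) G) + (T ^ t) (x - c • Y) := by
  induction t with
  | zero => simp
  | succ t ih =>
    have hB : B = Y + G - T Y := eq_sub_of_add_eq' hY.symm
    rw [Function.iterate_succ_apply', ih, Finset.sum_range_succ', hB, map_add, map_smul, map_add,
      map_sum]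
    simp only [← Module.End.mul_apply, ← pow_succ', pow_zero, Module.End.one_apply]
    module

variable [PartialOrder E]

/-- A positive functional `τ` bounding every positive vector by a multiple of the order unit `e`.
The model is the trace together with the identity matrix. -/
structure IsTraceFunctional (τ : E →ₗ[ℝ] ℝ) (e : E) : Prop where
  monotone : Monotone τ
  unit_nonneg : 0 ≤ e
  le_smul_unit : ∀ x, 0 ≤ x → x ≤ τ x • e

/-- The iterates of the positive operator `T` vanish asymptotically, as measured by the
functional `τ` on the positive cone. -/
def IsDecaying (τ : E →ₗ[ℝ] ℝ) (T : E →ₗ[ℝ] E) : Prop :=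
  ∀ x, 0 ≤ x → Tendsto (fun t : ℕ => τ ((T ^ t) x)) atTop (𝓝 0)

variable {τ : E →ₗ[ℝ] ℝ} {e : E}

theorem monotone_pow (hT : Monotone T) (t : ℕ) : Monotone (T ^ t : E →ₗ[ℝ] E) := by
  rw [Module.End.coe_pow]
  exact hT.iterate t

theorem pow_apply_nonneg (hT : Monotone T) (t : ℕ) {x : E} (hx : 0 ≤ x) : 0 ≤ (T ^ t) x := by
  simpa using monotone_pow hT t hx

theorem IsTraceFunctional.map_nonneg (hτ : IsTraceFunctional τ e) {x : E} (hx : 0 ≤ x) :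
    0 ≤ τ x := by
  simpa using hτ.monotone hx

theorem IsTraceFunctional.isDecaying (hτ : IsTraceFunctional τ e) (hT : Monotone T)
    (he : Tendsto (fun t : ℕ => τ ((T ^ t) e)) atTop (𝓝 0)) : IsDecaying τ T := by
  intro x hx
  refine squeeze_zero (fun t => hτ.map_nonneg (pow_apply_nonneg hT t hx)) (fun t => ?_)
    (by simpa using he.const_mul (τ x))
  calc τ ((T ^ t) x) ≤ τ ((T ^ t) (τ x • e)) :=
        hτ.monotone (monotone_pow hT t (hτ.le_smul_unit x hx))
    _ = τ x * τ ((T ^ t) e) := by simp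

variable [IsOrderedAddMonoid E] {X : ℕ → E} {c : ℝ}

theorem monotone_affine (hT : Monotone T) (b : E) : Monotone fun z => T z + b :=
  fun _ _ h => add_le_add_left (hT h) b

theorem affine_orbit_le (hT : Monotone T) (hY : Y + G = T Y + B)
    (hX : ∀ k, T (X k) + c • B ≤ X (k + 1)) (t : ℕ) :
    c • (Y + ∑ i ∈ Finset.range t, (T ^ i) G) + (T ^ t) (X 0 - c • Y) ≤ X t := by
  rw [← iterate_affine_of_add_eq hY]
  exact (monotone_affine hT _).seq_le_seq (x := fun k => (fun z => T z + c • B)^[k] (X 0)) t le_rfl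
    (fun k _ => (Function.iterate_succ_apply' _ _ _).le) fun k _ => hX k

theorem le_affine_orbit (hT : Monotone T) (hY : Y = T Y + B)
    (hX : ∀ k, X (k + 1) ≤ T (X k) + c • B) (t : ℕ) :
    X t ≤ c • Y + (T ^ t) (X 0 - c • Y) := by
  have horbit := iterate_affine_of_add_eq (G := 0) (by rwa [add_zero]) c (X 0) t
  simp only [map_zero, Finset.sum_const_zero, add_zero] at horbit
  rw [← horbit]
  exact (monotone_affine hT _).seq_le_seq (y := fun k => (fun z => T z + c • B)^[k] (X 0)) t le_rfl
    (fun k _ => hX k) fun k _ => (Function.iterate_succ_apply' (fun z => T z + c • B) _ _).ge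

theorem eventually_le_of_affine_le (hτ : IsTraceFunctional τ e) (hT : Monotone T)
    (hdecay : IsDecaying τ T) (hYpos : 0 ≤ Y) (hG : 0 ≤ G) (hY : Y + G = T Y + B)
    (hXpos : ∀ k, 0 ≤ X k)
    (hX : ∀ c < (1 : ℝ), ∀ᶠ k in atTop, T (X k) + c • B ≤ X (k + 1))
    {r : ℝ} (hr : r < τ Y) : ∀ᶠ k in atTop, r ≤ τ (X k) := by
  obtain ⟨c, ⟨hc0, hc1⟩, hcr⟩ : ∃ c ∈ Set.Ioo (0 : ℝ) 1, r < c * τ Y := by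
    have hlim : Tendsto (fun c : ℝ => c * τ Y) (𝓝[<] 1) (𝓝 (1 * τ Y)) :=
      (tendsto_id.mul_const _).mono_left nhdsWithin_le_nhds
    exact ((show ∀ᶠ c : ℝ in 𝓝[<] 1, c ∈ Set.Ioo 0 1 from Ioo_mem_nhdsLT zero_lt_one).and
      (hlim.eventually_const_lt (by rwa [one_mul]))).exists
  obtain ⟨s, hs⟩ := eventually_atTop.1 (hX c hc1)
  have hbound (t : ℕ) : c * τ Y - c * τ ((T ^ t) Y) ≤ τ (X (t + s)) := by
    have horbit := hτ.monotone (affine_orbit_le (X := fun t => X (t + s)) hT hY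
      (fun k => by simpa only [add_right_comm] using hs (k + s) (by omega)) t)
    have hsum : 0 ≤ τ (∑ i ∈ Finset.range t, (T ^ i) G) :=
      hτ.map_nonneg (Finset.sum_nonneg fun i _ => pow_apply_nonneg hT i hG)
    have hinit : 0 ≤ τ ((T ^ t) (X s)) := hτ.map_nonneg (pow_apply_nonneg hT t (hXpos s))
    simp only [map_add, map_sub, map_smul, smul_eq_mul, zero_add] at horbit
    linarith [mul_nonneg hc0.le hsum]
  have hlim : Tendsto (fun t : ℕ => c * τ Y - c * τ ((T ^ t) Y)) atTop (𝓝 (c * τ Y - c * 0)) :=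
    ((hdecay Y hYpos).const_mul c).const_sub _
  rw [← map_add_atTop_eq_nat s, eventually_map]
  filter_upwards [hlim.eventually_const_lt (by rwa [mul_zero, sub_zero])] with t ht
    using ht.le.trans (hbound t)

theorem eventually_ge_of_le_affine (hτ : IsTraceFunctional τ e) (hT : Monotone T)
    (hdecay : IsDecaying τ T) (hYpos : 0 ≤ Y) (hY : Y = T Y + B) (hXpos : ∀ k, 0 ≤ X k)
    (hX : ∀ c > (1 : ℝ), ∀ᶠ k in atTop, X (k + 1) ≤ T (X k) + c • B)
    {r : ℝ} (hr : τ Y < r) : ∀ᶠ k in atTop, τ (X k) ≤ r := by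
  obtain ⟨c, hc1, hcr⟩ : ∃ c : ℝ, 1 < c ∧ c * τ Y < r := by
    have hlim : Tendsto (fun c : ℝ => c * τ Y) (𝓝[>] 1) (𝓝 (1 * τ Y)) :=
      (tendsto_id.mul_const _).mono_left nhdsWithin_le_nhds
    exact (eventually_mem_nhdsWithin.and
      (hlim.eventually_lt_const (by rwa [one_mul]))).exists
  obtain ⟨s, hs⟩ := eventually_atTop.1 (hX c hc1)
  have hbound (t : ℕ) : τ (X (t + s)) ≤ c * τ Y + τ ((T ^ t) (X s)) := by
    have horbit := hτ.monotone (le_affine_orbit (X := fun t => X (t + s)) hT hY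
      (fun k => by simpa only [add_right_comm] using hs (k + s) (by omega)) t)
    have hYt : 0 ≤ τ ((T ^ t) Y) := hτ.map_nonneg (pow_apply_nonneg hT t hYpos)
    simp only [map_add, map_sub, map_smul, smul_eq_mul, zero_add] at horbit
    linarith [mul_nonneg (zero_le_one.trans hc1.le) hYt]
  have hlim : Tendsto (fun t : ℕ => c * τ Y + τ ((T ^ t) (X s))) atTop (𝓝 (c * τ Y + 0)) :=
    (hdecay _ (hXpos s)).const_add _
  rw [← map_add_atTop_eq_nat s, eventually_map]
  filter_upwards [hlim.eventually_lt_const (by rwa [add_zero])] with t ht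
    using (hbound t).trans ht.le

theorem eventually_ge_of_unbounded_sum (hτ : IsTraceFunctional τ e) (hT : Monotone T)
    (hYpos : 0 ≤ Y) (hG : 0 ≤ G) (hY : Y + G = T Y + B) (hc : 0 < c)
    (hX : ∀ k, T (X k) + c • B ≤ X (k + 1)) (hX0 : c • Y ≤ X 0)
    (hsum : ∀ b, ∃ k, b < ∑ t ∈ Finset.range k, τ ((T ^ t) G)) (r : ℝ) :
    ∀ᶠ k in atTop, r ≤ τ (X k) := by
  have hbound (t : ℕ) : c * ∑ i ∈ Finset.range t, τ ((T ^ i) G) ≤ τ (X t) := by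
    have horbit := hτ.monotone (affine_orbit_le hT hY hX t)
    have hinit := hτ.map_nonneg (pow_apply_nonneg hT t (sub_nonneg.2 hX0))
    simp only [map_add, map_sub, map_smul, map_sum, smul_eq_mul] at horbit hinit
    linarith [mul_nonneg hc.le (hτ.map_nonneg hYpos)]
  obtain ⟨N, hN⟩ := hsum (r / c)
  filter_upwards [eventually_ge_atTop N] with k hk
  calc r ≤ c * ∑ t ∈ Finset.range N, τ ((T ^ t) G) := ((div_lt_iff₀' hc).1 hN).le
    _ ≤ c * ∑ t ∈ Finset.range k, τ ((T ^ t) G) := by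
          gcongr
          exact fun i _ _ => hτ.map_nonneg (pow_apply_nonneg hT i hG)
    _ ≤ τ (X k) := hbound k

-- `P` is twice a partial sum of the Neumann series `∑ r ^ k T ^ k e`.
theorem exists_lyapunov [IsOrderedModule ℝ E] (hτ : IsTraceFunctional τ e) (hT : Monotone T) {r : ℝ}
    (hr : 1 < r) (hlim : Tendsto (fun k : ℕ => r ^ k * τ ((T ^ k) e)) atTop (𝓝 0)) :
    ∃ P, 0 ≤ P ∧ e + r • T P ≤ P := by
  obtain ⟨N, hN⟩ := (hlim.eventually_lt_const one_half_pos).exists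
  set P := ∑ k ∈ Finset.range N, r ^ k • (T ^ k) e
  have hP : 0 ≤ P := Finset.sum_nonneg fun k _ =>
    smul_nonneg (by positivity) (pow_apply_nonneg hT k hτ.unit_nonneg)
  have htelescope : e + r • T P = P + r ^ N • (T ^ N) e := by
    rw [← Finset.sum_range_succ (fun k => r ^ k • (T ^ k) e), Finset.sum_range_succ', map_sum,
      Finset.smul_sum]
    simp [smul_smul, pow_succ', add_comm]
  have htail : r ^ N • (T ^ N) e ≤ (1 / 2 : ℝ) • e := by
    calc r ^ N • (T ^ N) e ≤ r ^ N • τ ((T ^ N) e) • e := by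
          gcongr
          exact hτ.le_smul_unit _ (pow_apply_nonneg hT N hτ.unit_nonneg)
      _ = (r ^ N * τ ((T ^ N) e)) • e := smul_smul _ _ _
      _ ≤ (1 / 2 : ℝ) • e := smul_le_smul_of_nonneg_right hN.le hτ.unit_nonneg
  refine ⟨(2 : ℝ) • P, smul_nonneg zero_le_two hP, ?_⟩
  calc e + r • T ((2 : ℝ) • P) = (2 : ℝ) • (e + r • T P) - e := by rw [map_smul]; module
    _ ≤ (2 : ℝ) • (P + (1 / 2 : ℝ) • e) - e := by rw [htelescope]; gcongr
    _ = (2 : ℝ) • P := by module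

-- Telescoping `τ (T ^ t P)` bounds `∑ τ (T ^ t e)` by `τ P + c * b`.
theorem isDecaying_of_bounded_sum (hτ : IsTraceFunctional τ e) (hT : Monotone T) {S : E →ₗ[ℝ] E}
    {P : E} (hP : 0 ≤ P) {r b : ℝ} (hlyap : e + r • S P ≤ P) (hTP : T P ≤ r • S P + c • G)
    (hc : 0 ≤ c) (hb : ∀ k, ∑ t ∈ Finset.range k, τ ((T ^ t) G) ≤ b) : IsDecaying τ T := by
  have hstep (t : ℕ) :
      τ ((T ^ (t + 1)) P) + τ ((T ^ t) e) ≤ τ ((T ^ t) P) + c * τ ((T ^ t) G) := by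
    have hTPe : T P + e ≤ P + c • G := by
      calc T P + e ≤ (r • S P + c • G) + e := by gcongr
        _ = (e + r • S P) + c • G := by abel
        _ ≤ P + c • G := by gcongr
    simpa [pow_succ] using hτ.monotone (monotone_pow hT t hTPe)
  have hsum (k : ℕ) : τ ((T ^ k) P) + ∑ t ∈ Finset.range k, τ ((T ^ t) e) ≤
      τ P + c * ∑ t ∈ Finset.range k, τ ((T ^ t) G) := by
    induction k with
    | zero => simp
    | succ k ih =>
      rw [Finset.sum_range_succ, Finset.sum_range_succ, mul_add]
      linarith [hstep k]
  have hsummable : Summable fun t : ℕ => τ ((T ^ t) e) := by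
    refine summable_of_sum_range_le (c := τ P + c * b)
      (fun t => hτ.map_nonneg (pow_apply_nonneg hT t hτ.unit_nonneg)) fun k => ?_
    have hPk : 0 ≤ τ ((T ^ k) P) := hτ.map_nonneg (pow_apply_nonneg hT k hP)
    linarith [hsum k, mul_le_mul_of_nonneg_left (hb k) hc]
  exact hτ.isDecaying hT hsummable.tendsto_atTop_zero

end OrderedDynamics

section Domination

variable {E : Type*} [AddCommGroup E] [PartialOrder E] [Module ℝ E] {x y z : E}

/-- The vector `x` is bounded by a positive multiple of `z`. -/
def IsDominated (x z : E) : Prop :=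
  ∃ c : ℝ, 0 < c ∧ x ≤ c • z

namespace IsDominated

theorem of_le (h : x ≤ z) : IsDominated x z :=
  ⟨1, one_pos, by rwa [one_smul]⟩

theorem of_smul_le [PosSMulMono ℝ E] [PosSMulReflectLE ℝ E] {c : ℝ} (hc : 0 < c) (h : c • x ≤ z) :
    IsDominated x z :=
  ⟨c⁻¹, inv_pos.2 hc, (le_inv_smul_iff_of_pos hc).2 h⟩

theorem trans [PosSMulMono ℝ E] (hxy : IsDominated x y) (hyz : IsDominated y z) :
    IsDominated x z := by
  obtain ⟨a, ha, hx⟩ := hxy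
  obtain ⟨b, hb, hy⟩ := hyz
  refine ⟨a * b, mul_pos ha hb, hx.trans ?_⟩
  rw [mul_smul]
  exact smul_le_smul_of_nonneg_left hy ha.le

theorem smul [PosSMulMono ℝ E] {c : ℝ} (hc : 0 < c) (h : IsDominated x z) :
    IsDominated (c • x) z := by
  obtain ⟨a, ha, hx⟩ := h
  refine ⟨c * a, mul_pos hc ha, ?_⟩
  rw [mul_smul]
  exact smul_le_smul_of_nonneg_left hx hc.le

theorem add [IsOrderedAddMonoid E] (hx : IsDominated x z) (hy : IsDominated y z) :
    IsDominated (x + y) z := by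
  obtain ⟨a, ha, hx⟩ := hx
  obtain ⟨b, hb, hy⟩ := hy
  exact ⟨a + b, add_pos ha hb, by rw [add_smul]; exact add_le_add hx hy⟩

theorem sum [IsOrderedAddMonoid E] {ι : Type*} {s : Finset ι} {f : ι → E} (hz : 0 ≤ z)
    (h : ∀ i ∈ s, IsDominated (f i) z) : IsDominated (∑ i ∈ s, f i) z :=
  Finset.sum_induction f (IsDominated · z) (fun _ _ => add) (of_le hz) h

theorem pi [IsOrderedModule ℝ E] {ι : Type*} [Finite ι] {f g : ι → E} (hg : 0 ≤ g)
    (h : ∀ i, IsDominated (f i) (g i)) : IsDominated f g := by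
  choose c _ hfg using h
  obtain ⟨b, hb⟩ := Finite.bddAbove_range c
  refine ⟨max b 1, by positivity, fun i => (hfg i).trans ?_⟩
  exact smul_le_smul_of_nonneg_right ((hb ⟨i, rfl⟩).trans (le_max_left _ _)) (hg i)

end IsDominated

end Domination

section Loewner

open scoped MatrixOrder

variable {ι κ : Type*}

theorem exists_pos_smul_one_le [Finite κ] [DecidableEq κ] {M : Matrix κ κ ℝ} (hM : M.PosDef) :
    ∃ c : ℝ, 0 < c ∧ c • (1 : Matrix κ κ ℝ) ≤ M := by
  have := Fintype.ofFinite κ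
  rcases isEmpty_or_nonempty κ with h | h
  · exact ⟨1, one_pos, (Subsingleton.elim _ _).le⟩
  · have hspec : ∀ x ∈ spectrum ℝ M, 0 < x := by
      rw [hM.isHermitian.spectrum_real_eq_range_eigenvalues]
      exact Set.forall_mem_range.2 hM.eigenvalues_pos
    simpa only [Algebra.algebraMap_eq_smul_one] using
      (CFC.exists_pos_algebraMap_le_iff hM.isHermitian.isSelfAdjoint).2 hspec

theorem le_trace_smul_one [Fintype κ] [DecidableEq κ] {X : Matrix κ κ ℝ} (hX : 0 ≤ X) :
    X ≤ X.trace • (1 : Matrix κ κ ℝ) := by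
  have hpos := Matrix.nonneg_iff_posSemidef.1 hX
  have hspec : ∀ x ∈ spectrum ℝ X, x ≤ X.trace := by
    rw [hpos.isHermitian.spectrum_real_eq_range_eigenvalues, Set.forall_mem_range,
      hpos.isHermitian.trace_eq_sum_eigenvalues]
    exact fun i => Finset.single_le_sum (f := hpos.isHermitian.eigenvalues)
      (fun j _ => hpos.eigenvalues_nonneg j) (Finset.mem_univ i)
  simpa only [Algebra.algebraMap_eq_smul_one] using
    (le_algebraMap_iff_spectrum_le hpos.isHermitian.isSelfAdjoint).2 hspec

theorem IsDominated.of_posDef [Finite κ] {X M : Matrix κ κ ℝ} (hX : 0 ≤ X) (hM : M.PosDef) :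
    IsDominated X M := by
  classical
  have := Fintype.ofFinite κ
  obtain ⟨b, hb, hbM⟩ := exists_pos_smul_one_le hM
  have htrace := (Matrix.nonneg_iff_posSemidef.1 hX).trace_nonneg
  refine trans (y := (1 : Matrix κ κ ℝ)) ⟨X.trace + 1, by positivity, ?_⟩ (of_smul_le hb hbM)
  refine (le_trace_smul_one hX).trans (smul_le_smul_of_nonneg_right (by linarith) ?_)
  exact Matrix.PosSemidef.one.nonneg

variable [Fintype κ]

theorem conj_monotone [Finite ι] (B : Matrix ι κ ℝ) :
    Monotone fun X : Matrix κ κ ℝ => B * X * Bᵀ := by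
  intro X Z h
  have hB := (Matrix.nonneg_iff_posSemidef.1 (sub_nonneg.2 h)).mul_mul_conjTranspose_same B
  rw [Matrix.conjTranspose_eq_transpose_of_trivial, Matrix.mul_sub, Matrix.sub_mul] at hB
  exact sub_nonneg.1 hB.nonneg

theorem conj_nonneg [Finite ι] {X : Matrix κ κ ℝ} (hX : 0 ≤ X) (B : Matrix ι κ ℝ) :
    0 ≤ B * X * Bᵀ := by
  simpa using conj_monotone B hX

theorem IsDominated.conj [Finite ι] {X Z : Matrix κ κ ℝ} (h : IsDominated X Z)
    (B : Matrix ι κ ℝ) :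
    IsDominated (B * X * Bᵀ) (B * Z * Bᵀ) := by
  obtain ⟨c, hc, hX⟩ := h
  exact ⟨c, hc, by simpa using conj_monotone B hX⟩

theorem add_conj_le [Finite ι] {X : Matrix κ κ ℝ} (hX : 0 ≤ X) (U V : Matrix ι κ ℝ) {a : ℝ}
    (ha : 0 < a) :
    (U + V) * X * (U + V)ᵀ ≤ (1 + a) • (U * X * Uᵀ) + (1 + a⁻¹) • (V * X * Vᵀ) := by
  have := Fintype.ofFinite ι
  have hsq := smul_nonneg (inv_nonneg.2 ha.le) (conj_nonneg hX (a • U - V))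
  have hdiff : (1 + a) • (U * X * Uᵀ) + (1 + a⁻¹) • (V * X * Vᵀ) - (U + V) * X * (U + V)ᵀ =
      a⁻¹ • ((a • U - V) * X * (a • U - V)ᵀ) := by
    simp only [Matrix.transpose_sub, Matrix.transpose_add, Matrix.transpose_smul, Matrix.mul_add,
      Matrix.add_mul, Matrix.mul_sub, Matrix.sub_mul, Matrix.smul_mul, Matrix.mul_smul]
    match_scalars <;> field_simp <;> ring
  exact sub_nonneg.1 (hdiff ▸ hsq)

theorem isDominated_conj_mul [Fintype ι] {X : Matrix κ κ ℝ} {M : Matrix ι ι ℝ} (hX : 0 ≤ X)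
    (hM : M.PosDef) (W : Matrix κ ι ℝ) (H : Matrix ι κ ℝ) :
    IsDominated (W * H * X * (W * H)ᵀ) (W * M * Wᵀ) := by
  simpa only [Matrix.transpose_mul, Matrix.mul_assoc] using
    (IsDominated.of_posDef (conj_nonneg hX H) hM).conj W

theorem isDominated_conj_add_mul [Fintype ι] {X S : Matrix κ κ ℝ} {M : Matrix ι ι ℝ} (hX : 0 ≤ X)
    (hS : S.PosDef) (hM : M.PosDef) (F : Matrix κ κ ℝ) (W : Matrix κ ι ℝ) (H : Matrix ι κ ℝ) :
    IsDominated ((F + W * H) * X * (F + W * H)ᵀ) (F * S * Fᵀ + W * M * Wᵀ) := by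
  have hF : IsDominated (F * X * Fᵀ) (F * S * Fᵀ + W * M * Wᵀ) :=
    ((IsDominated.of_posDef hX hS).conj F).trans
      (.of_le (le_add_of_nonneg_right (conj_nonneg hM.posSemidef.nonneg W)))
  have hW : IsDominated (W * H * X * (W * H)ᵀ) (F * S * Fᵀ + W * M * Wᵀ) :=
    (isDominated_conj_mul hX hM W H).trans
      (.of_le (le_add_of_nonneg_left (conj_nonneg hS.posSemidef.nonneg F)))
  exact (IsDominated.of_le (add_conj_le hX F (W * H) one_pos)).trans
    ((hF.smul (by positivity)).add (hW.smul (by positivity)))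

/-- The sum of the traces of a family of matrices. For the mode-wise error covariances it is the
mean-square error. -/
noncomputable def totalTrace (ι κ : Type*) [Fintype ι] [Fintype κ] :
    (ι → Matrix κ κ ℝ) →ₗ[ℝ] ℝ :=
  ∑ i, Matrix.traceLinearMap κ ℝ ℝ ∘ₗ LinearMap.proj i

variable [Fintype ι]

theorem totalTrace_apply (X : ι → Matrix κ κ ℝ) : totalTrace ι κ X = ∑ i, (X i).trace := by
  simp [totalTrace]

theorem isTraceFunctional_totalTrace [DecidableEq κ] : IsTraceFunctional (totalTrace ι κ) 1 := by
  have hnonneg (X : ι → Matrix κ κ ℝ) (hX : 0 ≤ X) (i : ι) : 0 ≤ (X i).trace :=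
    (Matrix.nonneg_iff_posSemidef.1 (hX i)).trace_nonneg
  have hone : (0 : Matrix κ κ ℝ) ≤ 1 := Matrix.PosSemidef.one.nonneg
  refine ⟨(monotone_iff_map_nonneg _).2 fun X hX => ?_, fun _ => hone, fun X hX i => ?_⟩
  · rw [totalTrace_apply]
    exact Finset.sum_nonneg fun i _ => hnonneg X hX i
  · refine (le_trace_smul_one (hX i)).trans (smul_le_smul_of_nonneg_right ?_ hone)
    rw [totalTrace_apply]
    exact Finset.single_le_sum (f := fun j => (X j).trace) (fun j _ => hnonneg X hX j)
      (Finset.mem_univ i)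

end Loewner

section TransferOperator

/-- The transfer operator of the transition probabilities `T`: it moves the mass `V i` from the
state `i` to the states `j` in the proportions `T i j`. -/
noncomputable def transfer {ι M : Type*} [Fintype ι] [AddCommGroup M] [Module ℝ M]
    (T : ι → ι → ℝ) : (ι → M) →ₗ[ℝ] (ι → M) :=
  LinearMap.pi fun j => ∑ i, T i j • LinearMap.proj i

variable {ι M : Type*} [Fintype ι] [AddCommGroup M] [Module ℝ M] {T : ι → ι → ℝ} {μ : ι → ℝ}

theorem transfer_apply (T : ι → ι → ℝ) (V : ι → M) (j : ι) : transfer T V j = ∑ i, T i j • V i := by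
  simp [transfer]

/-- `T` are strictly positive transition probabilities on a finite set and `μ` is a strictly
positive stationary distribution for them. -/
structure IsPositiveChain (T : ι → ι → ℝ) (μ : ι → ℝ) : Prop where
  pos : ∀ i j, 0 < T i j
  sum_eq_one : ∀ i, ∑ j, T i j = 1
  stationary : transfer T μ = μ
  prob_pos : ∀ i, 0 < μ i
  sum_prob : ∑ i, μ i = 1

namespace IsPositiveChain

variable (hT : IsPositiveChain T μ)
include hT

theorem monotone_transfer [PartialOrder M] [IsOrderedAddMonoid M] [PosSMulMono ℝ M] :
    Monotone (transfer T : (ι → M) →ₗ[ℝ] (ι → M)) := fun V W h j => by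
  simp only [transfer_apply]
  exact Finset.sum_le_sum fun i _ => smul_le_smul_of_nonneg_left (h i) (hT.pos i j).le

theorem transfer_nonneg [PartialOrder M] [IsOrderedAddMonoid M] [PosSMulMono ℝ M] {V : ι → M}
    (hV : 0 ≤ V) : 0 ≤ transfer T V := by
  simpa using hT.monotone_transfer hV

theorem transfer_smul_mono [PartialOrder M] [IsOrderedAddMonoid M] [IsOrderedModule ℝ M]
    {V : ι → M} (hV : 0 ≤ V) {a b : ι → ℝ} (h : a ≤ b) : transfer T (a • V) ≤ transfer T (b • V) :=
  hT.monotone_transfer fun i => smul_le_smul_of_nonneg_right (h i) (hV i)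

theorem sum_transfer (π : ι → ℝ) : ∑ j, transfer T π j = ∑ i, π i := by
  simp only [transfer_apply, smul_eq_mul]
  rw [Finset.sum_comm]
  simp only [← Finset.sum_mul, hT.sum_eq_one, one_mul]

theorem pow_transfer_mem_stdSimplex {π : ι → ℝ} (hπ : π ∈ stdSimplex ℝ ι) (k : ℕ) :
    (transfer T ^ k) π ∈ stdSimplex ℝ ι := by
  have hpos : (0 : ι → ℝ) ≤ (transfer T ^ k) π := pow_apply_nonneg hT.monotone_transfer k hπ.1
  refine ⟨hpos, ?_⟩
  clear hpos
  induction k with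
  | zero => exact hπ.2
  | succ k ih => rw [pow_succ', Module.End.mul_apply, hT.sum_transfer, ih]

theorem prob_le_one (j : ι) : μ j ≤ 1 := by
  rw [← hT.sum_prob]
  exact Finset.single_le_sum (f := μ) (fun i _ => (hT.prob_pos i).le) (Finset.mem_univ j)

theorem exists_doeblin :
    ∃ ε ∈ Set.Ioc (0 : ℝ) 1, ∀ π : ι → ℝ, 0 ≤ π → (ε * ∑ i, π i) • μ ≤ transfer T π := by
  have : Nonempty ι := by
    by_contra h
    have := not_nonempty_iff.1 h
    simpa using hT.sum_prob
  obtain ⟨⟨i₀, j₀⟩, hmin⟩ := Finite.exists_min fun x : ι × ι => T x.1 x.2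
  have hle : T i₀ j₀ ≤ 1 := by
    rw [← hT.sum_eq_one i₀]
    exact Finset.single_le_sum (f := T i₀) (fun j _ => (hT.pos i₀ j).le) (Finset.mem_univ j₀)
  refine ⟨T i₀ j₀, ⟨hT.pos i₀ j₀, hle⟩, fun π hπ j => ?_⟩
  have hεπ : 0 ≤ T i₀ j₀ * ∑ i, π i :=
    mul_nonneg (hT.pos _ _).le (Finset.sum_nonneg fun i _ => hπ i)
  calc (T i₀ j₀ * ∑ i, π i) * μ j ≤ T i₀ j₀ * ∑ i, π i :=
      mul_le_of_le_one_right hεπ (hT.prob_le_one j)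
    _ = ∑ i, T i₀ j₀ * π i := Finset.mul_sum _ _ _
    _ ≤ ∑ i, T i j * π i :=
      Finset.sum_le_sum fun i _ => mul_le_mul_of_nonneg_right (hmin (i, j)) (hπ i)
    _ = transfer T π j := by simp only [transfer_apply, smul_eq_mul]

theorem smul_prob_le_pow_transfer {ε : ℝ}
    (hε : ∀ π : ι → ℝ, 0 ≤ π → (ε * ∑ i, π i) • μ ≤ transfer T π) {π : ι → ℝ}
    (hπ : π ∈ stdSimplex ℝ ι) (k : ℕ) : (1 - (1 - ε) ^ k) • μ ≤ (transfer T ^ k) π := by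
  induction k with
  | zero =>
    have hpos : 0 ≤ π := hπ.1
    simpa using hpos
  | succ k ih =>
    set c := 1 - (1 - ε) ^ k with hc
    have hsum : ∑ i, ((transfer T ^ k) π - c • μ) i = (1 - ε) ^ k := by
      simp only [Pi.sub_apply, Pi.smul_apply, smul_eq_mul, Finset.sum_sub_distrib,
        ← Finset.mul_sum, hT.sum_prob, (hT.pow_transfer_mem_stdSimplex hπ k).2, hc]
      ring
    have hstep := hε _ (sub_nonneg.2 ih)
    rw [hsum, map_sub, map_smul, hT.stationary, le_sub_iff_add_le] at hstep
    rw [pow_succ' (transfer T), Module.End.mul_apply]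
    refine le_of_eq_of_le ?_ hstep
    rw [← add_smul, hc]
    congr 1
    ring

theorem exists_smul_prob_le_pow_succ_transfer {π : ι → ℝ} (hπ : π ∈ stdSimplex ℝ ι) :
    ∃ ε : ℝ, 0 < ε ∧ ∀ k, ε • μ ≤ (transfer T ^ (k + 1)) π := by
  obtain ⟨ε, hε, hmin⟩ := hT.exists_doeblin
  refine ⟨ε, hε.1, fun k => ?_⟩
  simpa only [pow_succ', Module.End.mul_apply, (hT.pow_transfer_mem_stdSimplex hπ k).2, mul_one]
    using hmin _ (hT.pow_transfer_mem_stdSimplex hπ k).1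

theorem eventually_smul_prob_le {π : ι → ℝ} (hπ : π ∈ stdSimplex ℝ ι) {c : ℝ} (hc : c < 1) :
    ∀ᶠ k in atTop, c • μ ≤ (transfer T ^ k) π := by
  obtain ⟨ε, hε, hmin⟩ := hT.exists_doeblin
  have hlim : Tendsto (fun k => 1 - (1 - ε) ^ k) atTop (𝓝 (1 - 0)) :=
    (tendsto_pow_atTop_nhds_zero_of_lt_one (by linarith [hε.2]) (by linarith [hε.1])).const_sub 1
  filter_upwards [hlim.eventually_const_le (by simpa using hc)] with k hk
  exact (smul_le_smul_of_nonneg_right hk fun i => (hT.prob_pos i).le).trans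
    (hT.smul_prob_le_pow_transfer hmin hπ k)

theorem eventually_le_smul_prob {π : ι → ℝ} (hπ : π ∈ stdSimplex ℝ ι) {c : ℝ} (hc : 1 < c) :
    ∀ᶠ k in atTop, (transfer T ^ k) π ≤ c • μ := by
  simp only [Pi.le_def, eventually_all]
  intro j
  have hgap : 0 < (c - 1) * μ j := mul_pos (sub_pos.2 hc) (hT.prob_pos j)
  set b := 1 - (c - 1) * μ j with hb
  filter_upwards [hT.eventually_smul_prob_le hπ (show b < 1 by linarith)] with k hk
  have hsum : ∑ i, ((transfer T ^ k) π - b • μ) i = (c - 1) * μ j := by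
    simp only [Pi.sub_apply, Pi.smul_apply, smul_eq_mul, Finset.sum_sub_distrib,
      ← Finset.mul_sum, hT.sum_prob, (hT.pow_transfer_mem_stdSimplex hπ k).2, hb]
    ring
  have hj := Finset.single_le_sum (fun i _ => sub_nonneg.2 hk i) (Finset.mem_univ j)
  rw [hsum, Pi.sub_apply, Pi.smul_apply, smul_eq_mul] at hj
  have hbμ : b * μ j ≤ μ j := mul_le_of_le_one_left (hT.prob_pos j).le (by linarith)
  rw [Pi.smul_apply, smul_eq_mul]
  linarith

end IsPositiveChain

end TransferOperator

section JumpSystem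

open scoped MatrixOrder

variable {ι κ : Type*} [Fintype ι] [Fintype κ]

/-- The operator propagating the second moments `E (x x' 1_{θ = i})` along the jump linear system
`x(k+1) = F_{θ(k)} x(k)` whose mode `θ` has the transition probabilities `T`. -/
noncomputable def jumpOp (T : ι → ι → ℝ) (F : ι → Matrix κ κ ℝ) :
    (ι → Matrix κ κ ℝ) →ₗ[ℝ] (ι → Matrix κ κ ℝ) :=
  transfer T ∘ₗ LinearMap.pi fun i =>
    LinearMap.mulRight ℝ (F i)ᵀ ∘ₗ LinearMap.mulLeft ℝ (F i) ∘ₗ LinearMap.proj i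

theorem jumpOp_apply (T : ι → ι → ℝ) (F V : ι → Matrix κ κ ℝ) :
    jumpOp T F V = transfer T fun i => F i * V i * (F i)ᵀ :=
  rfl

/-- The second moments `E (x(k) x(k)' 1_{θ(k) = i})` of the jump linear system
`x(k+1) = F_{θ(k)} x(k) + u(k)`, where `u(k)` is white with covariance `N_{θ(k)}`, the initial state
has second moment `S` and the initial mode has the distribution `π`. -/
noncomputable def jumpCov (T : ι → ι → ℝ) (F N : ι → Matrix κ κ ℝ) (π : ι → ℝ)
    (S : Matrix κ κ ℝ) : ℕ → ι → Matrix κ κ ℝ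
  | 0 => fun i => π i • S
  | k + 1 => jumpOp T F (jumpCov T F N π S k) + transfer T ((transfer T ^ k) π • N)

theorem jumpCov_one (T : ι → ι → ℝ) (F N : ι → Matrix κ κ ℝ) (π : ι → ℝ) (S : Matrix κ κ ℝ) :
    jumpCov T F N π S 1 = transfer T fun i => π i • (F i * S * (F i)ᵀ + N i) := by
  rw [jumpCov, jumpCov, jumpOp_apply, ← map_add]
  congr 1
  funext i
  simp

namespace IsPositiveChain

variable {T : ι → ι → ℝ} {μ π : ι → ℝ} {F N Y G : ι → Matrix κ κ ℝ} {S : Matrix κ κ ℝ}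
  (hT : IsPositiveChain T μ)
include hT

theorem monotone_jumpOp (F : ι → Matrix κ κ ℝ) : Monotone (jumpOp T F) := fun V W h => by
  simp only [jumpOp_apply]
  exact hT.monotone_transfer fun i => conj_monotone (F i) (h i)

theorem isDecaying_jumpOp (hF : realSpectralRadius (jumpOp T F) < 1) :
    IsDecaying (totalTrace ι κ) (jumpOp T F) := by
  classical
  obtain ⟨r, hr, hlim⟩ := exists_tendsto_pow_apply_zero hF
  have hnonneg (t : ℕ) : 0 ≤ totalTrace ι κ ((jumpOp T F ^ t) 1) :=
    isTraceFunctional_totalTrace.map_nonneg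
      (pow_apply_nonneg (hT.monotone_jumpOp F) t isTraceFunctional_totalTrace.unit_nonneg)
  exact isTraceFunctional_totalTrace.isDecaying (hT.monotone_jumpOp F) (squeeze_zero hnonneg
    (fun t => le_mul_of_one_le_left (hnonneg t) (one_le_pow₀ hr.le)) (hlim _ 1))

theorem isDecaying_jumpOp_of_bounded_sum {ρ : Type*} [Fintype ρ] {F' : ι → Matrix κ κ ℝ}
    {W : ι → Matrix κ ρ ℝ} {H : ι → Matrix ρ κ ℝ} {M : ι → Matrix ρ ρ ℝ} {b : ℝ}
    (hF : realSpectralRadius (jumpOp T F) < 1) (hF' : ∀ i, F' i = F i + W i * H i)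
    (hM : ∀ i, (M i).PosDef) (hb : ∀ k, ∑ t ∈ Finset.range k,
      totalTrace ι κ ((jumpOp T F' ^ t) (transfer T fun i => W i * M i * (W i)ᵀ)) ≤ b) :
    IsDecaying (totalTrace ι κ) (jumpOp T F') := by
  classical
  obtain ⟨r, hr, hlim⟩ := exists_tendsto_pow_apply_zero hF
  obtain ⟨P, hP, hlyap⟩ := exists_lyapunov isTraceFunctional_totalTrace (hT.monotone_jumpOp F) hr
    (hlim _ 1)
  obtain ⟨d, hd, hdom⟩ : IsDominated (fun i => W i * H i * P i * (W i * H i)ᵀ)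
      fun i => W i * M i * (W i)ᵀ :=
    .pi (fun i => conj_nonneg (hM i).posSemidef.nonneg _) fun i =>
      isDominated_conj_mul (hP i) (hM i) _ _
  have ha : 0 < r - 1 := sub_pos.2 hr
  refine isDecaying_of_bounded_sum isTraceFunctional_totalTrace (hT.monotone_jumpOp F') hP
    (c := (1 + (r - 1)⁻¹) * d) hlyap ?_ (by positivity) hb
  rw [jumpOp_apply, jumpOp_apply, ← map_smul, ← map_smul, ← map_add]
  refine hT.monotone_transfer fun i => ?_
  rw [hF' i]
  calc _ ≤ (1 + (r - 1)) • (F i * P i * (F i)ᵀ) +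
        (1 + (r - 1)⁻¹) • (W i * H i * P i * (W i * H i)ᵀ) := add_conj_le (hP i) _ _ ha
    _ ≤ r • (F i * P i * (F i)ᵀ) + (1 + (r - 1)⁻¹) • d • (W i * M i * (W i)ᵀ) := by
      rw [add_sub_cancel]
      gcongr
      exact hdom i
    _ = _ := by rw [smul_smul]; rfl

variable (hπ : π ∈ stdSimplex ℝ ι)
include hπ

theorem jumpCov_nonneg (hN : 0 ≤ N) (hS : 0 ≤ S) (k : ℕ) : 0 ≤ jumpCov T F N π S k := by
  induction k with
  | zero => exact fun i => smul_nonneg (hπ.1 i) hS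
  | succ k ih =>
    refine add_nonneg ?_ (hT.transfer_nonneg fun i =>
      smul_nonneg ((hT.pow_transfer_mem_stdSimplex hπ k).1 i) (hN i))
    simpa using hT.monotone_jumpOp F ih

theorem isDominated_jumpCov_one_apply (hS : 0 ≤ S) (hN : 0 ≤ N) {i : ι} (hi : 0 < π i) (j : ι) :
    IsDominated (F i * S * (F i)ᵀ + N i) (jumpCov T F N π S 1 j) := by
  have hnonneg (i : ι) : 0 ≤ F i * S * (F i)ᵀ + N i := add_nonneg (conj_nonneg hS _) (hN i)
  rw [jumpCov_one, transfer_apply]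
  refine .of_smul_le (mul_pos (hT.pos i j) hi) ?_
  rw [mul_smul]
  exact Finset.single_le_sum (f := fun i => T i j • π i • (F i * S * (F i)ᵀ + N i)) (fun i _ =>
    smul_nonneg (hT.pos i j).le (smul_nonneg (hπ.1 i) (hnonneg i))) (Finset.mem_univ i)

-- By `A = F i + W i * H i`, the image of `Y i` under `A` is controlled by the two terms
-- `F i * S * (F i)ᵀ` and `W i * R * (W i)ᵀ`, and positivity of `T` spreads them to all modes.
theorem isDominated_jumpCov_one {ρ : Type*} [Fintype ρ] {A Q : Matrix κ κ ℝ} {R : Matrix ρ ρ ℝ}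
    {W : ι → Matrix κ ρ ℝ} {H : ι → Matrix ρ κ ℝ} (hS : S.PosDef) (hQ : 0 ≤ Q) (hR : R.PosDef)
    (hF : ∀ i, A = F i + W i * H i) (hN : ∀ i, N i = Q + W i * R * (W i)ᵀ) (hY0 : 0 ≤ Y)
    (hY : Y ≤ jumpOp T (fun _ => A) Y + transfer T (μ • fun _ => Q)) :
    IsDominated Y (jumpCov T F N π S 1) := by
  have hWR (i : ι) : 0 ≤ W i * R * (W i)ᵀ := conj_nonneg hR.posSemidef.nonneg _
  have hN0 : 0 ≤ N := fun i => hN i ▸ add_nonneg hQ (hWR i)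
  have hX0 : 0 ≤ jumpCov T F N π S 1 := hT.jumpCov_nonneg hπ hN0 hS.posSemidef.nonneg 1
  obtain ⟨i₀, hi₀⟩ : ∃ i, 0 < π i := by
    by_contra! h
    linarith [hπ.2, Finset.sum_nonpos fun i (_ : i ∈ Finset.univ) => h i]
  set V := F i₀ * S * (F i₀)ᵀ + W i₀ * R * (W i₀)ᵀ with hV
  have hV0 : 0 ≤ V := add_nonneg (conj_nonneg hS.posSemidef.nonneg _) (hWR i₀)
  have hinput (i : ι) : IsDominated (A * Y i * Aᵀ + μ i • Q) (V + Q) := by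
    refine .add (.trans ?_ (.of_le (le_add_of_nonneg_right hQ)))
      (.smul (hT.prob_pos i) (.of_le (le_add_of_nonneg_left hV0)))
    rw [hF i₀]
    exact isDominated_conj_add_mul (hY0 i) hS hR _ _ _
  have houtput (j : ι) : IsDominated (V + Q) (jumpCov T F N π S 1 j) := by
    rw [hV, add_assoc, add_comm _ Q, ← hN]
    exact hT.isDominated_jumpCov_one_apply hπ hS.posSemidef.nonneg hN0 hi₀ j
  refine (IsDominated.of_le hY).trans (.pi hX0 fun j => .trans ?_ (houtput j))
  rw [jumpOp_apply, ← map_add, transfer_apply]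
  exact .sum (add_nonneg hV0 hQ) fun i _ => .smul (hT.pos i j) (hinput i)

variable (hN : 0 ≤ N)
include hN

theorem eventually_le_totalTrace_jumpCov_of_unbounded_sum (hY0 : 0 ≤ Y) (hG : 0 ≤ G)
    (hY : Y + transfer T G = jumpOp T F Y + transfer T (μ • N))
    (hY1 : IsDominated Y (jumpCov T F N π S 1))
    (hsum : ∀ b, ∃ k, b < ∑ t ∈ Finset.range k, totalTrace ι κ ((jumpOp T F ^ t) (transfer T G)))
    (r : ℝ) : ∀ᶠ k in atTop, r ≤ totalTrace ι κ (jumpCov T F N π S k) := by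
  classical
  obtain ⟨ε, hε, hεμ⟩ := hT.exists_smul_prob_le_pow_succ_transfer hπ
  obtain ⟨d, hd, hdY⟩ := hY1
  have hc : 0 < min ε d⁻¹ := by positivity
  rw [← map_add_atTop_eq_nat 1, eventually_map]
  refine eventually_ge_of_unbounded_sum (X := fun k => jumpCov T F N π S (k + 1))
    isTraceFunctional_totalTrace (hT.monotone_jumpOp F) hY0 (hT.transfer_nonneg hG) hY hc
    (fun k => ?_) ?_ hsum r
  · have hμ : min ε d⁻¹ • μ ≤ (transfer T ^ (k + 1)) π :=
      (smul_le_smul_of_nonneg_right (min_le_left _ _) fun i => (hT.prob_pos i).le).trans (hεμ k)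
    rw [← map_smul, ← smul_assoc]
    exact add_le_add_right (hT.transfer_smul_mono hN hμ) _
  · calc min ε d⁻¹ • Y ≤ d⁻¹ • Y := smul_le_smul_of_nonneg_right (min_le_right _ _) hY0
      _ ≤ d⁻¹ • d • jumpCov T F N π S 1 := by gcongr
      _ = jumpCov T F N π S 1 := inv_smul_smul₀ hd.ne' _

variable (hS : 0 ≤ S)
include hS

theorem eventually_le_totalTrace_jumpCov (hF : IsDecaying (totalTrace ι κ) (jumpOp T F))
    (hY0 : 0 ≤ Y) (hG : 0 ≤ G) (hY : Y + transfer T G = jumpOp T F Y + transfer T (μ • N))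
    {r : ℝ} (hr : r < totalTrace ι κ Y) :
    ∀ᶠ k in atTop, r ≤ totalTrace ι κ (jumpCov T F N π S k) := by
  classical
  refine eventually_le_of_affine_le isTraceFunctional_totalTrace (hT.monotone_jumpOp F) hF hY0
    (hT.transfer_nonneg hG) hY (hT.jumpCov_nonneg hπ hN hS) (fun c hc => ?_) hr
  filter_upwards [hT.eventually_smul_prob_le hπ hc] with k hk
  rw [← map_smul, ← smul_assoc]
  exact add_le_add_right (hT.transfer_smul_mono hN hk) _

theorem tendsto_totalTrace_jumpCov (hF : IsDecaying (totalTrace ι κ) (jumpOp T F))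
    (hY0 : 0 ≤ Y) (hY : Y = jumpOp T F Y + transfer T (μ • N)) :
    Tendsto (fun k => totalTrace ι κ (jumpCov T F N π S k)) atTop (𝓝 (totalTrace ι κ Y)) := by
  classical
  refine tendsto_order.2 ⟨fun a ha => ?_, fun a ha => ?_⟩
  · obtain ⟨b, hab, hb⟩ := exists_between ha
    filter_upwards [hT.eventually_le_totalTrace_jumpCov hπ hN hS hF hY0 le_rfl (by simpa using hY)
      hb] with k hk using hab.trans_le hk
  · obtain ⟨b, hb, hba⟩ := exists_between ha
    filter_upwards [eventually_ge_of_le_affine isTraceFunctional_totalTrace (hT.monotone_jumpOp F)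
      hF hY0 hY (hT.jumpCov_nonneg hπ hN hS) (fun c hc => by
        filter_upwards [hT.eventually_le_smul_prob hπ hc] with k hk
        rw [← map_smul, ← smul_assoc]
        exact add_le_add_right (hT.transfer_smul_mono hN hk) _) hb] with k hk using hk.trans_lt hba

end IsPositiveChain

end JumpSystem

section ModeChain

variable {m : ℕ} {p q : Fin m → ℝ}

theorem sum_prod_apply_bool (f : Fin m → Bool → ℝ) :
    ∑ i : Mode m, ∏ l, f l (i l) = ∏ l, (f l true + f l false) := by
  simpa only [Fintype.sum_bool, Fintype.piFinset_univ] using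
    (Finset.prod_univ_sum (fun _ : Fin m => (Finset.univ : Finset Bool)) f).symm

theorem tpm_pos {p q : ℝ} (hp : 0 < p ∧ p < 1) (hq : 0 < q ∧ q < 1) (i j : Bool) :
    0 < tpm p q i j := by
  cases i <;> cases j <;> simp only [tpm] <;> linarith

theorem isPositiveChain_mode (hp : ∀ l, 0 < p l ∧ p l < 1) (hq : ∀ l, 0 < q l ∧ q l < 1) :
    IsPositiveChain (modeTPM p q) (modeProb p q) where
  pos i j := Finset.prod_pos fun l _ => tpm_pos (hp l) (hq l) (i l) (j l)
  sum_eq_one i := by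
    simp only [modeTPM]
    rw [sum_prod_apply_bool fun l => tpm (p l) (q l) (i l)]
    exact Finset.prod_eq_one fun l _ => by cases i l <;> simp [tpm]
  stationary := by
    funext j
    simp only [transfer_apply, smul_eq_mul, modeTPM, modeProb, ← Finset.prod_mul_distrib]
    rw [sum_prod_apply_bool fun l b => tpm (p l) (q l) b (j l) * limitProb (p l) (q l) b]
    refine Finset.prod_congr rfl fun l _ => ?_
    have := (hp l).1
    have := (hq l).1
    cases j l <;> simp only [limitProb, tpm] <;> field_simp <;> ring
  prob_pos i := Finset.prod_pos fun l _ => by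
    have := (hp l).1
    have := (hq l).1
    cases i l <;> simp only [limitProb] <;> positivity
  sum_prob := by
    simp only [modeProb]
    rw [sum_prod_apply_bool fun l => limitProb (p l) (q l)]
    refine Finset.prod_eq_one fun l _ => ?_
    have := (hp l).1
    have := (hq l).1
    simp only [limitProb]
    field_simp
    ring

end ModeChain

section Riccati

open scoped MatrixOrder

theorem riccati_completion {ι κ : Type*} [Fintype ι] [Fintype κ] [DecidableEq ι]
    {A Y : Matrix κ κ ℝ} {H : Matrix ι κ ℝ} {N M : Matrix ι ι ℝ} (hY : Y.IsSymm) (hM : M.IsSymm)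
    (hunit : IsUnit M.det) (hMeq : M = H * Y * Hᵀ + N) (U : Matrix κ ι ℝ) :
    (A - U * H) * Y * (A - U * H)ᵀ + U * N * Uᵀ = A * Y * Aᵀ - A * Y * Hᵀ * M⁻¹ * H * Y * Aᵀ +
      (A * Y * Hᵀ * M⁻¹ - U) * M * (A * Y * Hᵀ * M⁻¹ - U)ᵀ := by
  set K := A * Y * Hᵀ * M⁻¹
  have hKM : K * M = A * Y * Hᵀ := Matrix.nonsing_inv_mul_cancel_right _ _ hunit
  have hMK : M * Kᵀ = H * Y * Aᵀ := by
    simpa only [Matrix.transpose_mul, Matrix.transpose_transpose, hM.eq, hY.eq, Matrix.mul_assoc]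
      using congrArg Matrix.transpose hKM
  have hsq : (K - U) * M * (K - U)ᵀ = K * H * Y * Aᵀ - A * Y * Hᵀ * Uᵀ - U * H * Y * Aᵀ
      + U * M * Uᵀ := by
    have hKMK : K * M * Kᵀ = K * H * Y * Aᵀ := by simp only [Matrix.mul_assoc, hMK]
    have hUMK : U * M * Kᵀ = U * H * Y * Aᵀ := by simp only [Matrix.mul_assoc, hMK]
    rw [Matrix.transpose_sub, Matrix.mul_sub, Matrix.sub_mul, Matrix.sub_mul, Matrix.sub_mul, hKMK,
      hUMK, hKM]
    abel
  rw [hsq, hMeq]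
  simp only [Matrix.transpose_sub, Matrix.transpose_mul, Matrix.mul_sub, Matrix.sub_mul,
    Matrix.mul_add, Matrix.add_mul, Matrix.mul_assoc]
  abel

variable {n m : ℕ}

/-- The matrix `A - L_i H_i` of the error dynamics in mode `i`. -/
def errMat (A : Matrix (Fin n) (Fin n) ℝ) (C : Matrix (Fin m) (Fin n) ℝ)
    (L : Mode m → Matrix (Fin n) (Fin m) ℝ) (i : Mode m) : Matrix (Fin n) (Fin n) ℝ :=
  A - L i * obsMat C i

/-- The covariance `Q + L_i D_i R D_i L_i'` of the noise entering the error dynamics in mode `i`. -/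
def noiseMat (Q : Matrix (Fin n) (Fin n) ℝ) (R : Matrix (Fin m) (Fin m) ℝ)
    (L : Mode m → Matrix (Fin n) (Fin m) ℝ) (i : Mode m) : Matrix (Fin n) (Fin n) ℝ :=
  Q + L i * dropMat i * R * (L i * dropMat i)ᵀ

/-- The deviation of the gains `L` from the gains `K(Y)`, up to the action on dropped
measurements. -/
noncomputable def gainGap (A : Matrix (Fin n) (Fin n) ℝ) (C : Matrix (Fin m) (Fin n) ℝ)
    (R : Matrix (Fin m) (Fin m) ℝ) (p q : Fin m → ℝ) (Y : Mode m → Matrix (Fin n) (Fin n) ℝ)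
    (L : Mode m → Matrix (Fin n) (Fin m) ℝ) (i : Mode m) : Matrix (Fin n) (Fin m) ℝ :=
  kalmanGain A C R p q Y i - L i * dropMat i

/-- The mode-wise error covariances of the jump estimator with gains `L`, for the initial mode
distribution `π` and the second moment `S` of the initial error. -/
noncomputable abbrev errCov (A : Matrix (Fin n) (Fin n) ℝ) (C : Matrix (Fin m) (Fin n) ℝ)
    (Q : Matrix (Fin n) (Fin n) ℝ) (R : Matrix (Fin m) (Fin m) ℝ) (p q : Fin m → ℝ)
    (L : Mode m → Matrix (Fin n) (Fin m) ℝ) (π : Mode m → ℝ) (S : Matrix (Fin n) (Fin n) ℝ) :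
    ℕ → Mode m → Matrix (Fin n) (Fin n) ℝ :=
  jumpCov (modeTPM p q) (errMat A C L) (noiseMat Q R L) π S

theorem dropMat_mul_dropMat (i : Mode m) : dropMat i * dropMat i = dropMat i := by
  simp only [dropMat, Matrix.diagonal_mul_diagonal, mul_ite, mul_one, mul_zero]
  congr 1
  funext l
  split <;> rfl

theorem dropMat_mul_obsMat (C : Matrix (Fin m) (Fin n) ℝ) (i : Mode m) :
    dropMat i * obsMat C i = obsMat C i := by
  rw [obsMat, ← Matrix.mul_assoc, dropMat_mul_dropMat]

theorem obsMat_transpose_mul_dropMat (C : Matrix (Fin m) (Fin n) ℝ) (i : Mode m) :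
    (obsMat C i)ᵀ * dropMat i = (obsMat C i)ᵀ := by
  conv_rhs => rw [← dropMat_mul_obsMat C i, Matrix.transpose_mul]
  rw [dropMat, Matrix.diagonal_transpose]

theorem commute_dropMat_of_isDiag {R : Matrix (Fin m) (Fin m) ℝ} (hR : R.IsDiag) (i : Mode m) :
    Commute (dropMat i) R := by
  rw [← hR.diagonal_diag, dropMat]
  exact Matrix.commute_diagonal _ _

variable {A : Matrix (Fin n) (Fin n) ℝ} {C : Matrix (Fin m) (Fin n) ℝ}
  {Q : Matrix (Fin n) (Fin n) ℝ} {R : Matrix (Fin m) (Fin m) ℝ} {p q : Fin m → ℝ}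
  {Y : Mode m → Matrix (Fin n) (Fin n) ℝ} {L : Mode m → Matrix (Fin n) (Fin m) ℝ}

theorem errMat_eq_sub (A : Matrix (Fin n) (Fin n) ℝ) (C : Matrix (Fin m) (Fin n) ℝ)
    (L : Mode m → Matrix (Fin n) (Fin m) ℝ) (i : Mode m) :
    errMat A C L i = A - L i * dropMat i * obsMat C i := by
  rw [errMat, Matrix.mul_assoc, dropMat_mul_obsMat]

theorem errMat_eq_add_gainGap (L : Mode m → Matrix (Fin n) (Fin m) ℝ) (i : Mode m) :
    errMat A C L i =
      errMat A C (kalmanGain A C R p q Y) i + gainGap A C R p q Y L i * obsMat C i := by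
  rw [errMat_eq_sub A C L, errMat, gainGap, Matrix.sub_mul]
  abel

theorem gainOp_neg (A : Matrix (Fin n) (Fin n) ℝ) (C : Matrix (Fin m) (Fin n) ℝ)
    (p q : Fin m → ℝ) (L : Mode m → Matrix (Fin n) (Fin m) ℝ) :
    gainOp A C p q (fun i => -L i) = jumpOp (modeTPM p q) (errMat A C L) := by
  refine LinearMap.ext fun V => funext fun j => ?_
  simp only [gainOp, LinearMap.coe_mk, AddHom.coe_mk, jumpOp_apply, transfer_apply, errMat,
    Matrix.neg_mul, sub_eq_add_neg]

theorem isMSStable_iff : IsMSStable A C p q L ↔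
    realSpectralRadius (jumpOp (modeTPM p q) (errMat A C L)) < 1 := by
  rw [IsMSStable, gainOp_neg]

theorem noiseMat_nonneg (hQ : Q.PosSemidef) (hR : R.PosDef)
    (L : Mode m → Matrix (Fin n) (Fin m) ℝ) : 0 ≤ noiseMat Q R L := fun _ =>
  add_nonneg hQ.nonneg (conj_nonneg hR.posSemidef.nonneg _)

theorem innovMat_posDef (hT : IsPositiveChain (modeTPM p q) (modeProb p q)) (hR : R.PosDef)
    (hY : ∀ i, (Y i).PosSemidef) (i : Mode m) : (innovMat C R p q Y i).PosDef :=
  Matrix.PosDef.posSemidef_add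
    (Matrix.nonneg_iff_posSemidef.1 (conj_nonneg (hY i).nonneg (obsMat C i)))
    (hR.smul (hT.prob_pos i))

theorem kalmanGain_mul_dropMat (hRdiag : R.IsDiag) (i : Mode m) :
    kalmanGain A C R p q Y i * dropMat i = kalmanGain A C R p q Y i := by
  have hcomm : Commute (dropMat i) (innovMat C R p q Y i) := by
    refine .add_right ?_ ((commute_dropMat_of_isDiag hRdiag i).smul_right _)
    rw [commute_iff_eq, Matrix.mul_assoc, Matrix.mul_assoc, Matrix.mul_assoc,
      obsMat_transpose_mul_dropMat, ← Matrix.mul_assoc, dropMat_mul_obsMat]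
  have hinv : Commute (innovMat C R p q Y i)⁻¹ (dropMat i) := by
    simpa only [Matrix.zpow_neg_one] using Matrix.Commute.zpow_left hcomm.symm (-1)
  rw [kalmanGain, Matrix.mul_assoc, hinv.eq, ← Matrix.mul_assoc,
    Matrix.mul_assoc _ _ (dropMat i), obsMat_transpose_mul_dropMat]

theorem gainGap_kalmanGain (hRdiag : R.IsDiag) :
    gainGap A C R p q Y (kalmanGain A C R p q Y) = 0 := by
  funext i
  rw [gainGap, kalmanGain_mul_dropMat hRdiag, sub_self, Pi.zero_apply]

namespace IsMSStabilizingSolution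

variable (hY : IsMSStabilizingSolution A C Q R p q Y)
  (hT : IsPositiveChain (modeTPM p q) (modeProb p q))
include hY

theorem nonneg : 0 ≤ Y := fun i => (hY.posSemidef i).nonneg

include hT

theorem add_transfer_gainGap (hR : R.PosDef) (L : Mode m → Matrix (Fin n) (Fin m) ℝ) :
    Y + transfer (modeTPM p q) (fun i => gainGap A C R p q Y L i * innovMat C R p q Y i *
        (gainGap A C R p q Y L i)ᵀ) =
      jumpOp (modeTPM p q) (errMat A C L) Y +
        transfer (modeTPM p q) (modeProb p q • noiseMat Q R L) := by
  have hcare : Y = transfer (modeTPM p q) fun i => A * Y i * Aᵀ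
      - A * Y i * (obsMat C i)ᵀ * (innovMat C R p q Y i)⁻¹ * obsMat C i * Y i * Aᵀ
      + modeProb p q i • Q := by
    funext j
    rw [transfer_apply]
    exact hY.care j
  nth_rw 1 [hcare]
  rw [jumpOp_apply, ← map_add, ← map_add]
  congr 1
  funext i
  have hM := innovMat_posDef (C := C) hT hR hY.posSemidef i
  have hsquare := riccati_completion (A := A)
    (Matrix.isHermitian_iff_isSymm.1 (hY.posSemidef i).isHermitian)
    (Matrix.isHermitian_iff_isSymm.1 hM.isHermitian) hM.det_pos.ne'.isUnit rfl (L i * dropMat i)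
  rw [← errMat_eq_sub] at hsquare
  simp only [Pi.add_apply, Pi.smul_apply', noiseMat, smul_add, gainGap, kalmanGain]
  rw [add_right_comm, ← hsquare, Matrix.mul_smul, Matrix.smul_mul]
  abel

theorem le_openLoop (hR : R.PosDef) :
    Y ≤ jumpOp (modeTPM p q) (fun _ => A) Y +
      transfer (modeTPM p q) (modeProb p q • fun _ => Q) := by
  have hbalance := hY.add_transfer_gainGap hT hR 0
  have hgap : 0 ≤ transfer (modeTPM p q) fun i => gainGap A C R p q Y 0 i *
      innovMat C R p q Y i * (gainGap A C R p q Y 0 i)ᵀ :=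
    hT.transfer_nonneg fun i =>
      conj_nonneg (innovMat_posDef hT hR hY.posSemidef i).posSemidef.nonneg _
  have hF : errMat A C 0 = fun _ => A := by funext i; simp [errMat]
  have hN : noiseMat Q R (0 : Mode m → Matrix (Fin n) (Fin m) ℝ) = fun _ => Q := by
    funext i; simp [noiseMat]
  rw [hF, hN] at hbalance
  exact hbalance ▸ le_add_of_nonneg_right hgap

variable {π : Mode m → ℝ} {S : Matrix (Fin n) (Fin n) ℝ} (hπ : π ∈ stdSimplex ℝ (Mode m))
  (hQ : Q.PosSemidef) (hR : R.PosDef)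
include hπ hQ hR

theorem tendsto_totalTrace_errCov (hRdiag : R.IsDiag) (hS : 0 ≤ S) :
    Tendsto (fun k => totalTrace _ _ (errCov A C Q R p q (kalmanGain A C R p q Y) π S k)) atTop
      (𝓝 (totalTrace _ _ Y)) := by
  have hF := hT.isDecaying_jumpOp (isMSStable_iff.1 hY.stable)
  refine hT.tendsto_totalTrace_jumpCov hπ (noiseMat_nonneg hQ hR _) hS hF hY.nonneg ?_
  have hbalance := hY.add_transfer_gainGap hT hR (kalmanGain A C R p q Y)
  have hzero : transfer (modeTPM p q) (fun _ => (0 : Matrix (Fin n) (Fin n) ℝ)) = 0 := map_zero _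
  simpa only [gainGap_kalmanGain hRdiag, Pi.zero_apply, Matrix.zero_mul, hzero, add_zero]
    using hbalance

theorem eventually_le_totalTrace_errCov (hF : IsDecaying (totalTrace _ _)
    (jumpOp (modeTPM p q) (errMat A C L))) (hS : 0 ≤ S) {r : ℝ} (hr : r < totalTrace _ _ Y) :
    ∀ᶠ k in atTop, r ≤ totalTrace _ _ (errCov A C Q R p q L π S k) :=
  hT.eventually_le_totalTrace_jumpCov hπ (noiseMat_nonneg hQ hR L) hS hF hY.nonneg
    (fun i => conj_nonneg (innovMat_posDef hT hR hY.posSemidef i).posSemidef.nonneg _)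
    (hY.add_transfer_gainGap hT hR L) hr

theorem eventually_le_totalTrace_errCov_of_posDef (hS : S.PosDef) {r : ℝ}
    (hr : r < totalTrace _ _ Y) :
    ∀ᶠ k in atTop, r ≤ totalTrace _ _ (errCov A C Q R p q L π S k) := by
  have hM (i : Mode m) := innovMat_posDef (C := C) hT hR hY.posSemidef i
  by_cases hbdd : ∃ b, ∀ k, ∑ t ∈ Finset.range k, totalTrace _ _
      ((jumpOp (modeTPM p q) (errMat A C L) ^ t) (transfer (modeTPM p q) fun i =>
        gainGap A C R p q Y L i * innovMat C R p q Y i * (gainGap A C R p q Y L i)ᵀ)) ≤ b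
  · obtain ⟨b, hb⟩ := hbdd
    exact hY.eventually_le_totalTrace_errCov hT hπ hQ hR (hT.isDecaying_jumpOp_of_bounded_sum
      (isMSStable_iff.1 hY.stable) (errMat_eq_add_gainGap L) hM hb) hS.posSemidef.nonneg hr
  · push Not at hbdd
    refine hT.eventually_le_totalTrace_jumpCov_of_unbounded_sum hπ (noiseMat_nonneg hQ hR L)
      hY.nonneg (fun i => conj_nonneg (hM i).posSemidef.nonneg _)
      (hY.add_transfer_gainGap hT hR L) ?_ hbdd r
    exact hT.isDominated_jumpCov_one hπ hS hQ.nonneg hR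
      (fun i => by rw [errMat_eq_sub, sub_add_cancel]) (fun _ => rfl) hY.nonneg
      (hY.le_openLoop hT hR)

end IsMSStabilizingSolution

end Riccati

section MarkovChain

variable {Ω ι : Type*} [MeasurableSpace Ω] {P : Measure Ω}

theorem setIntegral_comp_eq_sum {α E : Type*} [Fintype α] [MeasurableSpace α]
    [MeasurableSingletonClass α] [NormedAddCommGroup E] [NormedSpace ℝ E] [CompleteSpace E]
    [IsFiniteMeasure P] {X : Ω → α} (hX : Measurable X) (g : α → E) (s : Set Ω) :
    ∫ ω in s, g (X ω) ∂P = ∑ r, P.real (X ⁻¹' {r} ∩ s) • g r := by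
  rw [← integral_map hX.aemeasurable .of_discrete, integral_fintype .of_finite]
  refine Finset.sum_congr rfl fun r _ => ?_
  rw [map_measureReal_apply hX (measurableSet_singleton r),
    measureReal_restrict_apply (hX (measurableSet_singleton r))]

variable {θ : ℕ → Ω → ι} {T : ι → ι → ℝ}

theorem IsMarkovChain.measureReal_history_inter (hM : IsMarkovChain P θ T)
    (hT : ∀ i j, 0 ≤ T i j) {k : ℕ} (r : Set.Iic k → ι) (j : ι) :
    P.real ((fun ω (l : Set.Iic k) => θ l ω) ⁻¹' {r} ∩ θ (k + 1) ⁻¹' {j}) =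
      P.real ((fun ω (l : Set.Iic k) => θ l ω) ⁻¹' {r}) * T (r ⟨k, Set.self_mem_Iic⟩) j := by
  let a : ℕ → ι := fun l => if h : l ≤ k then r ⟨l, h⟩ else j
  have hpast : (fun ω (l : Set.Iic k) => θ l ω) ⁻¹' {r} = {ω | ∀ l ≤ k, θ l ω = a l} := by
    ext ω
    simp +contextual [a, funext_iff]
  have hstep : (fun ω (l : Set.Iic k) => θ l ω) ⁻¹' {r} ∩ θ (k + 1) ⁻¹' {j} =
      {ω | ∀ l ≤ k + 1, θ l ω = a l} := by
    ext ω
    simp [hpast, Nat.le_succ_iff, or_imp, forall_and, a]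
  have hk : a k = r ⟨k, Set.self_mem_Iic⟩ := dif_pos le_rfl
  have hk1 : a (k + 1) = j := dif_neg (by lia)
  rw [hstep, hpast, measureReal_def, hM k a, ENNReal.toReal_mul, hk, hk1,
    ENNReal.toReal_ofReal (hT _ _), measureReal_def]

variable [MeasurableSpace ι] [MeasurableSingletonClass ι]

theorem integrable_of_dependsOn_Iic [Finite ι] {E : Type*} [NormedAddCommGroup E]
    [IsFiniteMeasure P] (hθ : ∀ k, Measurable (θ k)) {f : (ℕ → ι) → E} {k : ℕ}
    (hf : DependsOn f (Set.Iic k)) :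
    Integrable (fun ω => f fun l => θ l ω) P := by
  obtain ⟨g, rfl⟩ := dependsOn_iff_exists_comp.1 hf
  exact Integrable.of_finite.comp_measurable (measurable_pi_lambda _ fun l : Set.Iic k => hθ l)

namespace IsMarkovChain

variable [Fintype ι]

theorem setIntegral_succ {E : Type*} [NormedAddCommGroup E] [NormedSpace ℝ E] [CompleteSpace E]
    [IsFiniteMeasure P] (hM : IsMarkovChain P θ T) (hT : ∀ i j, 0 ≤ T i j)
    (hθ : ∀ k, Measurable (θ k)) {f : (ℕ → ι) → E} {k : ℕ} (hf : DependsOn f (Set.Iic k)) :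
    (fun j => ∫ ω in θ (k + 1) ⁻¹' {j}, f (fun l => θ l ω) ∂P) =
      transfer T fun i => ∫ ω in θ k ⁻¹' {i}, f (fun l => θ l ω) ∂P := by
  classical
  obtain ⟨g, rfl⟩ := dependsOn_iff_exists_comp.1 hf
  let X : Ω → Set.Iic k → ι := fun ω l => θ l ω
  have hX : Measurable X := measurable_pi_lambda _ fun l => hθ l
  have hpresent (r : Set.Iic k → ι) (i : ι) : P.real (X ⁻¹' {r} ∩ θ k ⁻¹' {i}) =
      if r ⟨k, Set.self_mem_Iic⟩ = i then P.real (X ⁻¹' {r}) else 0 := by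
    have hk {ω : Ω} (hω : X ω = r) : θ k ω = r ⟨k, Set.self_mem_Iic⟩ :=
      congrFun hω ⟨k, Set.self_mem_Iic⟩
    split_ifs with hi
    · exact congrArg P.real (Set.inter_eq_left.2 fun ω hω => (hk hω).trans hi)
    · have hempty : X ⁻¹' {r} ∩ θ k ⁻¹' {i} = ∅ :=
        Set.eq_empty_of_forall_notMem fun ω hω => hi ((hk hω.1).symm.trans hω.2)
      rw [hempty, measureReal_empty]
  funext j
  calc ∫ ω in θ (k + 1) ⁻¹' {j}, g (X ω) ∂P
      = ∑ r, (P.real (X ⁻¹' {r}) * T (r ⟨k, Set.self_mem_Iic⟩) j) • g r := by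
        rw [setIntegral_comp_eq_sum hX]
        simp only [X, hM.measureReal_history_inter hT]
    _ = ∑ i, T i j • ∑ r, P.real (X ⁻¹' {r} ∩ θ k ⁻¹' {i}) • g r := by
        simp only [Finset.smul_sum, smul_smul, hpresent]
        rw [Finset.sum_comm]
        simp [mul_comm]
    _ = transfer T (fun i => ∫ ω in θ k ⁻¹' {i}, g (X ω) ∂P) j := by
        simp only [transfer_apply, setIntegral_comp_eq_sum hX]

theorem measureReal_eq_pow_transfer [IsFiniteMeasure P] (hM : IsMarkovChain P θ T)
    (hT : ∀ i j, 0 ≤ T i j) (hθ : ∀ k, Measurable (θ k)) (k : ℕ) :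
    (fun j => P.real (θ k ⁻¹' {j})) = (transfer T ^ k) fun j => P.real (θ 0 ⁻¹' {j}) := by
  induction k with
  | zero => rfl
  | succ k ih =>
    rw [pow_succ', Module.End.mul_apply, ← ih]
    simpa using hM.setIntegral_succ hT hθ (dependsOn_const (1 : ℝ) |>.mono (Set.empty_subset _))

end IsMarkovChain

theorem isMarkovChain_pi {m : ℕ} {p q : Fin m → ℝ} {γ : Fin m → ℕ → Ω → Bool}
    (hpq : ∀ l i j, 0 ≤ tpm (p l) (q l) i j) (hind : iIndepFun (fun i ω k => γ i k ω) P)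
    (hM : ∀ i, IsMarkovChain P (γ i) (tpm (p i) (q i))) :
    IsMarkovChain P (fun k ω i => γ i k ω) (modeTPM p q) := by
  have hpath (k : ℕ) (a : ℕ → Mode m) : P {ω | ∀ l ≤ k, (fun i => γ i l ω) = a l} =
      ∏ i, P {ω | ∀ l ≤ k, γ i l ω = a l i} := by
    have hmeas (i : Fin m) : MeasurableSet {g : ℕ → Bool | ∀ l ≤ k, g l = a l i} := by
      measurability
    refine .trans (congrArg P ?_)
      (hind.measure_inter_preimage_eq_mul Finset.univ fun i _ => hmeas i)
    ext ω
    simp only [Set.mem_ofPred_eq, Set.mem_iInter, Set.mem_preimage, Finset.mem_univ, funext_iff]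
    tauto
  intro k a
  rw [hpath, hpath, modeTPM, ENNReal.ofReal_prod_of_nonneg fun i _ => hpq i _ _,
    ← Finset.prod_mul_distrib]
  exact Finset.prod_congr rfl fun i _ => hM i k fun l => a l i

end MarkovChain

section ModeAverages

variable {Ω ι κ : Type*} [MeasurableSpace Ω] {P : Measure Ω} [Fintype κ]

/-- The covariance of the state of `x(k+1) = F_k x(k) + u(k)` for uncorrelated inputs `u(k)` of
covariance `N_k` and an initial state of covariance `S`. -/
def stateCov (F N : ℕ → Matrix κ κ ℝ) (S : Matrix κ κ ℝ) : ℕ → Matrix κ κ ℝ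
  | 0 => S
  | k + 1 => F k * stateCov F N S k * (F k)ᵀ + N k

theorem dependsOn_stateCov (F N : ι → Matrix κ κ ℝ) (S : Matrix κ κ ℝ) (k : ℕ) :
    DependsOn (fun θ : ℕ → ι => stateCov (fun l => F (θ l)) (fun l => N (θ l)) S k)
      (Set.Iio k) := by
  induction k with
  | zero => exact fun _ _ _ => rfl
  | succ k ih =>
    intro θ θ' h
    have hpast := ih fun l hl => h l (lt_trans hl k.lt_succ_self)
    simp only [stateCov, h k k.lt_succ_self]
    simp only at hpast
    rw [hpast]

variable [MeasurableSpace ι] [MeasurableSingletonClass ι] {θ : ℕ → Ω → ι} [IsFiniteMeasure P]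

theorem integrable_stateCov [Finite ι] (hθ : ∀ k, Measurable (θ k)) (F N : ι → Matrix κ κ ℝ)
    (S : Matrix κ κ ℝ) (k : ℕ) (φ : Matrix κ κ ℝ →ₗ[ℝ] ℝ) :
    Integrable (fun ω => φ (stateCov (fun l => F (θ l ω)) (fun l => N (θ l ω)) S k)) P :=
  integrable_of_dependsOn_Iic hθ
    (f := fun θ => φ (stateCov (fun l => F (θ l)) (fun l => N (θ l)) S k)) fun _ _ h =>
      congrArg φ (((dependsOn_stateCov F N S k).mono Set.Iio_subset_Iic_self) h)

namespace IsMarkovChain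

variable [Fintype ι] {T : ι → ι → ℝ}

-- The induction runs over all linear functionals at once, because the recursion turns `φ` into
-- `X ↦ φ (F i * X * (F i)ᵀ)`.
theorem setIntegral_stateCov (hM : IsMarkovChain P θ T) (hT : ∀ i j, 0 ≤ T i j)
    (hθ : ∀ k, Measurable (θ k)) (F N : ι → Matrix κ κ ℝ) (S : Matrix κ κ ℝ) (k : ℕ)
    (φ : Matrix κ κ ℝ →ₗ[ℝ] ℝ) (j : ι) :
    ∫ ω in θ k ⁻¹' {j}, φ (stateCov (fun l => F (θ l ω)) (fun l => N (θ l ω)) S k) ∂P =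
      φ (jumpCov T F N (fun i => P.real (θ 0 ⁻¹' {i})) S k j) := by
  induction k generalizing φ j with
  | zero => simp [stateCov, jumpCov]
  | succ k ih =>
    have hstep (i : ι) :
        ∫ ω in θ k ⁻¹' {i}, φ (stateCov (fun l => F (θ l ω)) (fun l => N (θ l ω)) S (k + 1)) ∂P =
          φ (F i * jumpCov T F N (fun i => P.real (θ 0 ⁻¹' {i})) S k i * (F i)ᵀ) +
            P.real (θ k ⁻¹' {i}) * φ (N i) := by
      let φF : Matrix κ κ ℝ →ₗ[ℝ] ℝ :=
        φ ∘ₗ LinearMap.mulRight ℝ (F i)ᵀ ∘ₗ LinearMap.mulLeft ℝ (F i)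
      calc _ = ∫ ω in θ k ⁻¹' {i},
              φF (stateCov (fun l => F (θ l ω)) (fun l => N (θ l ω)) S k) + φ (N i) ∂P := by
            refine setIntegral_congr_fun (hθ k (measurableSet_singleton i)) fun ω hω => ?_
            have hω : θ k ω = i := hω
            simp [stateCov, hω, φF]
        _ = φF (jumpCov T F N (fun i => P.real (θ 0 ⁻¹' {i})) S k i) +
              P.real (θ k ⁻¹' {i}) * φ (N i) := by
            rw [integral_add (integrable_stateCov hθ F N S k φF).restrict (integrable_const _),
              ih, setIntegral_const, smul_eq_mul]
    have hdep : DependsOn (fun θ : ℕ → ι =>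
        φ (stateCov (fun l => F (θ l)) (fun l => N (θ l)) S (k + 1))) (Set.Iic k) := fun _ _ h =>
      congrArg φ (dependsOn_stateCov F N S (k + 1) fun l hl => h l (Nat.lt_succ_iff.1 hl))
    rw [congrFun (hM.setIntegral_succ hT hθ hdep) j]
    simp only [hstep, jumpCov, jumpOp_apply, transfer_apply, Pi.add_apply, Pi.smul_apply', map_add,
      map_sum, map_smul, ← hM.measureReal_eq_pow_transfer hT hθ, smul_eq_mul, mul_add,
      Finset.sum_add_distrib]

theorem integral_trace_stateCov (hM : IsMarkovChain P θ T) (hT : ∀ i j, 0 ≤ T i j)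
    (hθ : ∀ k, Measurable (θ k)) (F N : ι → Matrix κ κ ℝ) (S : Matrix κ κ ℝ) (k : ℕ) :
    ∫ ω, (stateCov (fun l => F (θ l ω)) (fun l => N (θ l ω)) S k).trace ∂P =
      totalTrace ι κ (jumpCov T F N (fun j => P.real (θ 0 ⁻¹' {j})) S k) := by
  let tr := Matrix.traceLinearMap κ ℝ ℝ
  have hcover : ⋃ j, θ k ⁻¹' {j} = Set.univ := by
    rw [← Set.preimage_iUnion, Set.iUnion_of_singleton, Set.preimage_univ]
  calc _ = ∫ ω in ⋃ j, θ k ⁻¹' {j},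
          tr (stateCov (fun l => F (θ l ω)) (fun l => N (θ l ω)) S k) ∂P := by
        rw [hcover, setIntegral_univ]
        rfl
    _ = ∑ j, tr (jumpCov T F N (fun j => P.real (θ 0 ⁻¹' {j})) S k j) := by
        rw [integral_iUnion_fintype (fun j => hθ k (measurableSet_singleton j))
          (pairwise_disjoint_fiber (θ k))
          fun j => (integrable_stateCov hθ F N S k tr).integrableOn]
        exact Finset.sum_congr rfl fun j _ => hM.setIntegral_stateCov hT hθ F N S k tr j
    _ = _ := (totalTrace_apply _).symm

end IsMarkovChain

end ModeAverages

section CrossMoment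

variable {Ω ι κ : Type*} [MeasurableSpace Ω] {P : Measure Ω}

/-- The matrix `E (f g')` of the mixed second moments of two random vectors. -/
noncomputable def crossMoment (P : Measure Ω) (f : Ω → ι → ℝ) (g : Ω → κ → ℝ) : Matrix ι κ ℝ :=
  Matrix.of fun i j => ∫ ω, f ω i * g ω j ∂P

theorem transpose_crossMoment (f : Ω → ι → ℝ) (g : Ω → κ → ℝ) :
    (crossMoment P f g)ᵀ = crossMoment P g f := by
  ext i j
  simp only [crossMoment, Matrix.transpose_apply, Matrix.of_apply, mul_comm]

theorem crossMoment_eq_zero_comm {f : Ω → ι → ℝ} {g : Ω → κ → ℝ} :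
    crossMoment P f g = 0 ↔ crossMoment P g f = 0 := by
  rw [← transpose_crossMoment, Matrix.transpose_eq_zero]

variable [Fintype ι] [Fintype κ]

theorem integrable_mul_of_memLp {f : Ω → ι → ℝ} {g : Ω → κ → ℝ} (hf : MemLp f 2 P)
    (hg : MemLp g 2 P) (i : ι) (j : κ) : Integrable (fun ω => f ω i * g ω j) P :=
  (hf.eval i).integrable_mul (hg.eval j)

theorem memLp_mulVec {f : Ω → ι → ℝ} (hf : MemLp f 2 P) (M : Matrix κ ι ℝ) :
    MemLp (fun ω => M *ᵥ f ω) 2 P :=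
  M.mulVecLin.toContinuousLinearMap.comp_memLp' hf

theorem crossMoment_mulVec_left {α : Type*} {f : Ω → ι → ℝ} {g : Ω → κ → ℝ} (hf : MemLp f 2 P)
    (hg : MemLp g 2 P) (M : Matrix α ι ℝ) :
    crossMoment P (fun ω => M *ᵥ f ω) g = M * crossMoment P f g := by
  ext i j
  simp only [crossMoment, Matrix.of_apply, Matrix.mul_apply, Matrix.mulVec, dotProduct,
    Finset.sum_mul, mul_assoc]
  rw [integral_finsetSum _ fun a _ => (integrable_mul_of_memLp hf hg a j).const_mul _]
  simp only [integral_const_mul]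

theorem crossMoment_mulVec_mulVec {α β : Type*} [Finite β] {f : Ω → ι → ℝ}
    {g : Ω → κ → ℝ} (hf : MemLp f 2 P) (hg : MemLp g 2 P) (M : Matrix α ι ℝ) (N : Matrix β κ ℝ) :
    crossMoment P (fun ω => M *ᵥ f ω) (fun ω => N *ᵥ g ω) = M * crossMoment P f g * Nᵀ := by
  cases nonempty_fintype β
  rw [crossMoment_mulVec_left hf (memLp_mulVec hg N), ← transpose_crossMoment,
    crossMoment_mulVec_left hg hf, Matrix.transpose_mul, transpose_crossMoment, Matrix.mul_assoc]

theorem crossMoment_add_left {f f' : Ω → ι → ℝ} {g : Ω → κ → ℝ} (hf : MemLp f 2 P)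
    (hf' : MemLp f' 2 P) (hg : MemLp g 2 P) :
    crossMoment P (f + f') g = crossMoment P f g + crossMoment P f' g := by
  ext i j
  simp only [crossMoment, Matrix.of_apply, Matrix.add_apply, Pi.add_apply, add_mul]
  exact integral_add (integrable_mul_of_memLp hf hg i j) (integrable_mul_of_memLp hf' hg i j)

theorem crossMoment_add_add_of_eq_zero {f f' : Ω → ι → ℝ} {g g' : Ω → κ → ℝ} (hf : MemLp f 2 P)
    (hf' : MemLp f' 2 P) (hg : MemLp g 2 P) (hg' : MemLp g' 2 P)
    (hfg' : crossMoment P f g' = 0) (hgf' : crossMoment P g f' = 0) :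
    crossMoment P (f + f') (g + g') = crossMoment P f g + crossMoment P f' g' := by
  rw [← transpose_crossMoment, crossMoment_add_left hg hg' (hf.add hf'), Matrix.transpose_add,
    transpose_crossMoment, transpose_crossMoment, crossMoment_add_left hf hf' hg,
    crossMoment_add_left hf hf' hg', hfg', crossMoment_eq_zero_comm.1 hgf', add_zero, zero_add]

theorem crossMoment_eq_zero_of_indepFun {f : Ω → ι → ℝ} {g : Ω → κ → ℝ} (h : IndepFun f g P)
    (hf : MemLp f 2 P) (hg : MemLp g 2 P) (hmean : ∀ j, ∫ ω, g ω j ∂P = 0) :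
    crossMoment P f g = 0 := by
  ext i j
  have hij : IndepFun (fun ω => f ω i) (fun ω => g ω j) P :=
    h.comp (measurable_pi_apply i) (measurable_pi_apply j)
  rw [crossMoment, Matrix.of_apply,
    hij.integral_fun_mul_eq_mul_integral (hf.eval i).1 (hg.eval j).1, hmean, mul_zero,
    Matrix.zero_apply]

theorem posSemidef_crossMoment_self {f : Ω → ι → ℝ} (hf : MemLp f 2 P) :
    (crossMoment P f f).PosSemidef := by
  refine .of_dotProduct_mulVec_nonneg (transpose_crossMoment f f) fun x => ?_
  have hsq : star x ⬝ᵥ crossMoment P f f *ᵥ x = ∫ ω, (x ⬝ᵥ f ω) * (x ⬝ᵥ f ω) ∂P :=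
    calc _ = (Matrix.replicateRow Unit x * crossMoment P f f *
            (Matrix.replicateRow Unit x)ᵀ) () () := by
          rw [Matrix.mul_assoc]
          rfl
      _ = _ := by
          rw [← crossMoment_mulVec_mulVec hf hf]
          rfl
  exact hsq ▸ integral_nonneg fun ω => mul_self_nonneg _

theorem lintegral_norm_sq_eq_trace_crossMoment {f : Ω → ι → ℝ} (hf : MemLp f 2 P) :
    ∫⁻ ω, ENNReal.ofReal (‖WithLp.toLp 2 (f ω)‖ ^ 2) ∂P =
      ENNReal.ofReal (crossMoment P f f).trace := by
  have hint (i : ι) : Integrable (fun ω => f ω i * f ω i) P := integrable_mul_of_memLp hf hf i i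
  simp only [EuclideanSpace.real_norm_sq_eq]
  simp only [sq]
  rw [← ofReal_integral_eq_lintegral_ofReal (integrable_finsetSum _ fun i _ => hint i)
    (.of_forall fun ω => Finset.sum_nonneg fun i _ => mul_self_nonneg _),
    integral_finsetSum _ fun i _ => hint i]
  rfl

end CrossMoment

section DrivenState

variable {Ω κ : Type*} [MeasurableSpace Ω] {P : Measure Ω} [Fintype κ]

/-- The state of the linear system `x(k+1) = F_k x(k) + u(k)`, `x(0) = x₀`. -/
def drivenState (F : ℕ → Matrix κ κ ℝ) (x₀ : κ → ℝ) (u : ℕ → κ → ℝ) : ℕ → κ → ℝ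
  | 0 => x₀
  | k + 1 => F k *ᵥ drivenState F x₀ u k + u k

variable {F N : ℕ → Matrix κ κ ℝ} {S : Matrix κ κ ℝ} {x₀ : Ω → κ → ℝ} {u : ℕ → Ω → κ → ℝ}

theorem memLp_drivenState (F : ℕ → Matrix κ κ ℝ) (hx₀ : MemLp x₀ 2 P) (hu : ∀ k, MemLp (u k) 2 P)
    (k : ℕ) : MemLp (fun ω => drivenState F (x₀ ω) (fun l => u l ω) k) 2 P := by
  induction k with
  | zero => exact hx₀
  | succ k ih => exact (memLp_mulVec ih (F k)).add (hu k)

theorem crossMoment_drivenState_input (hx₀ : MemLp x₀ 2 P) (hu : ∀ k, MemLp (u k) 2 P)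
    (hx₀u : ∀ l, crossMoment P x₀ (u l) = 0)
    (huu : ∀ k l, k ≠ l → crossMoment P (u k) (u l) = 0) {k l : ℕ} (hkl : k ≤ l) :
    crossMoment P (fun ω => drivenState F (x₀ ω) (fun i => u i ω) k) (u l) = 0 := by
  induction k with
  | zero => exact hx₀u l
  | succ k ih =>
    have hx := memLp_drivenState F hx₀ hu k
    refine (crossMoment_add_left (memLp_mulVec hx (F k)) (hu k) (hu l)).trans ?_
    rw [crossMoment_mulVec_left hx (hu l), ih (Nat.le_of_succ_le hkl),
      huu k l (Nat.ne_of_lt hkl), Matrix.mul_zero, add_zero]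

theorem crossMoment_drivenState_self (hx₀ : MemLp x₀ 2 P) (hu : ∀ k, MemLp (u k) 2 P)
    (hx₀u : ∀ l, crossMoment P x₀ (u l) = 0)
    (huu : ∀ k l, crossMoment P (u k) (u l) = if k = l then N k else 0) (k : ℕ) :
    crossMoment P (fun ω => drivenState F (x₀ ω) (fun l => u l ω) k)
        (fun ω => drivenState F (x₀ ω) (fun l => u l ω) k) =
      stateCov F N (crossMoment P x₀ x₀) k := by
  induction k with
  | zero => rfl
  | succ k ih =>
    have hx := memLp_drivenState F hx₀ hu k
    have hcross : crossMoment P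
        (fun ω => F k *ᵥ drivenState F (x₀ ω) (fun l => u l ω) k) (u k) = 0 := by
      rw [crossMoment_mulVec_left hx (hu k), crossMoment_drivenState_input hx₀ hu hx₀u
        (fun i j hij => (huu i j).trans (if_neg hij)) le_rfl, Matrix.mul_zero]
    refine (crossMoment_add_add_of_eq_zero (memLp_mulVec hx (F k)) (hu k) (memLp_mulVec hx (F k))
      (hu k) hcross hcross).trans ?_
    rw [crossMoment_mulVec_mulVec hx hx, ih, huu, if_pos rfl, stateCov]

end DrivenState

section Cost

theorem lintegral_comp_prodMk_of_indepFun {Ω α β : Type*} [MeasurableSpace Ω] [MeasurableSpace α]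
    [MeasurableSpace β] {P : Measure Ω} [IsFiniteMeasure P] {X : Ω → α} {Z : Ω → β}
    (h : IndepFun X Z P) (hX : Measurable X) (hZ : Measurable Z) {φ : α × β → ℝ≥0∞}
    (hφ : Measurable φ) :
    ∫⁻ ω, φ (X ω, Z ω) ∂P = ∫⁻ ω, ∫⁻ ω', φ (X ω, Z ω') ∂P ∂P := by
  rw [← lintegral_map hφ (hX.prodMk hZ),
    (indepFun_iff_map_prod_eq_prod_map_map hX.aemeasurable hZ.aemeasurable).1 h,
    lintegral_prod _ hφ.aemeasurable, lintegral_map hφ.lintegral_prod_right' hX]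
  exact lintegral_congr fun ω => lintegral_map (hφ.comp measurable_prodMk_left) hZ

theorem ofReal_le_liminf_ofReal {u : ℕ → ℝ} {a : ℝ} (h : ∀ r < a, ∀ᶠ k in atTop, r ≤ u k) :
    ENNReal.ofReal a ≤ liminf (fun k => ENNReal.ofReal (u k)) atTop := by
  have hr (r : ℝ) (hr : r < a) :
      ENNReal.ofReal r ≤ liminf (fun k => ENNReal.ofReal (u k)) atTop :=
    le_liminf_of_le (by isBoundedDefault) ((h r hr).mono fun k => ENNReal.ofReal_le_ofReal)
  exact le_of_tendsto (x := 𝓝[<] a) ENNReal.continuous_ofReal.continuousWithinAt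
    (eventually_mem_nhdsWithin.mono hr)

theorem measureReal_preimage_mem_stdSimplex {Ω α : Type*} [MeasurableSpace Ω] [Fintype α]
    [MeasurableSpace α] [MeasurableSingletonClass α] {P : Measure Ω} [IsProbabilityMeasure P]
    {X : Ω → α} (hX : Measurable X) : (fun j => P.real (X ⁻¹' {j})) ∈ stdSimplex ℝ α := by
  refine ⟨fun _ => measureReal_nonneg, ?_⟩
  rw [sum_measureReal_preimage_singleton _ fun j _ => hX (measurableSet_singleton j),
    Finset.coe_univ, Set.preimage_univ, probReal_univ]

variable {n m : ℕ}

/-- The input of the error dynamics: process noise minus injected measurement noise. -/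
def errNoise (L : Mode m → Matrix (Fin n) (Fin m) ℝ) (θ : ℕ → Mode m) (w : ℕ → Fin n → ℝ)
    (v : ℕ → Fin m → ℝ) (k : ℕ) : Fin n → ℝ :=
  w k + -(L (θ k) * dropMat (θ k)) *ᵥ v k

/-- The estimation error along a path `θ` of the mode, started at `e₀`. -/
def estError (A : Matrix (Fin n) (Fin n) ℝ) (C : Matrix (Fin m) (Fin n) ℝ)
    (L : Mode m → Matrix (Fin n) (Fin m) ℝ) (θ : ℕ → Mode m) (e₀ : Fin n → ℝ)
    (w : ℕ → Fin n → ℝ) (v : ℕ → Fin m → ℝ) : ℕ → Fin n → ℝ :=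
  drivenState (fun k => errMat A C L (θ k)) e₀ (errNoise L θ w v)

theorem state_sub_estimate (A : Matrix (Fin n) (Fin n) ℝ) (C : Matrix (Fin m) (Fin n) ℝ)
    (L : Mode m → Matrix (Fin n) (Fin m) ℝ) (θ : ℕ → Mode m) (x₀ z₀ : Fin n → ℝ)
    (w : ℕ → Fin n → ℝ) (v : ℕ → Fin m → ℝ) (k : ℕ) :
    state A x₀ w k - estimate A C L θ (received C θ (state A x₀ w) v) z₀ k =
      estError A C L θ (x₀ - z₀) w v k := by
  induction k with
  | zero => rfl
  | succ k ih =>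
    rw [estError, drivenState, ← estError, ← ih]
    simp only [state, estimate, errNoise, received, errMat, obsMat,
      Matrix.mulVec_sub, Matrix.sub_mulVec, Matrix.neg_mulVec, Matrix.mulVec_add,
      ← Matrix.mulVec_mulVec]
    abel

theorem measurable_mulVec_of_countable {α β ι κ : Type*} [MeasurableSpace α] [MeasurableSpace β]
    [Countable β] [MeasurableSingletonClass β] [Finite ι] [Fintype κ] (G : β → Matrix ι κ ℝ)
    {θ : α → β} {f : α → κ → ℝ} (hθ : Measurable θ) (hf : Measurable f) :
    Measurable fun y => G (θ y) *ᵥ f y :=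
  (measurable_from_prod_countable_right (f := fun z : β × (κ → ℝ) => G z.1 *ᵥ z.2) fun i =>
    (G i).mulVecLin.continuous_of_finiteDimensional.measurable).comp (hθ.prodMk hf)

theorem measurable_estError (A : Matrix (Fin n) (Fin n) ℝ) (C : Matrix (Fin m) (Fin n) ℝ)
    (L : Mode m → Matrix (Fin n) (Fin m) ℝ) (z₀ : Fin n → ℝ) (k : ℕ) :
    Measurable fun y : (Fin m → ℕ → Bool) × ((Fin n → ℝ) × (ℕ → Fin n → ℝ) × (ℕ → Fin m → ℝ)) =>
      estError A C L (fun l i => y.1 i l) (y.2.1 - z₀) y.2.2.1 y.2.2.2 k := by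
  induction k with
  | zero => exact (measurable_fst.comp measurable_snd).sub_const z₀
  | succ k ih =>
    have hmode : Measurable fun y : (Fin m → ℕ → Bool) ×
        ((Fin n → ℝ) × (ℕ → Fin n → ℝ) × (ℕ → Fin m → ℝ)) => (fun i => y.1 i k : Mode m) := by
      fun_prop
    have hnoise : Measurable fun y : (Fin m → ℕ → Bool) ×
        ((Fin n → ℝ) × (ℕ → Fin n → ℝ) × (ℕ → Fin m → ℝ)) =>
        errNoise L (fun l i => y.1 i l) y.2.2.1 y.2.2.2 k :=
      .add (by fun_prop)
        (measurable_mulVec_of_countable (fun i => -(L i * dropMat i)) hmode (by fun_prop))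
    exact (measurable_mulVec_of_countable (errMat A C L) hmode ih).add hnoise

variable {Ω : Type*} [MeasurableSpace Ω] {P : Measure Ω}

namespace IsWhiteNoise

variable {d : ℕ} {u : ℕ → Ω → Fin d → ℝ} {S : Matrix (Fin d) (Fin d) ℝ} (hu : IsWhiteNoise P u S)
include hu

theorem memLp_two (k : ℕ) : MemLp (u k) 2 P :=
  MemLp.of_eval (hu.memLp k)

theorem crossMoment_eq (k l : ℕ) : crossMoment P (u k) (u l) = if k = l then S else 0 := by
  ext a b
  rw [crossMoment, Matrix.of_apply, hu.covariance]
  split_ifs <;> rfl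

end IsWhiteNoise

/-- The second moment of the initial estimation error. -/
noncomputable def initErrMoment (P : Measure Ω) (x₀ : Ω → Fin n → ℝ) (z₀ : Fin n → ℝ) :
    Matrix (Fin n) (Fin n) ℝ :=
  crossMoment P (fun ω => x₀ ω - z₀) fun ω => x₀ ω - z₀

variable {w : ℕ → Ω → Fin n → ℝ} {v : ℕ → Ω → Fin m → ℝ} {Q : Matrix (Fin n) (Fin n) ℝ}
  {R : Matrix (Fin m) (Fin m) ℝ}

theorem memLp_errNoise (L : Mode m → Matrix (Fin n) (Fin m) ℝ) (θ : ℕ → Mode m)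
    (hw : IsWhiteNoise P w Q) (hv : IsWhiteNoise P v R) (k : ℕ) :
    MemLp (fun ω => errNoise L θ (fun l => w l ω) (fun l => v l ω) k) 2 P :=
  (hw.memLp_two k).add (memLp_mulVec (hv.memLp_two k) _)

theorem crossMoment_errNoise (L : Mode m → Matrix (Fin n) (Fin m) ℝ) (θ : ℕ → Mode m)
    (hw : IsWhiteNoise P w Q) (hv : IsWhiteNoise P v R)
    (hwv : ∀ k l, crossMoment P (w k) (v l) = 0) (k l : ℕ) :
    crossMoment P (fun ω => errNoise L θ (fun l => w l ω) (fun l => v l ω) k)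
        (fun ω => errNoise L θ (fun l => w l ω) (fun l => v l ω) l) =
      if k = l then noiseMat Q R L (θ k) else 0 := by
  have hGv (k : ℕ) : MemLp (fun ω => -(L (θ k) * dropMat (θ k)) *ᵥ v k ω) 2 P :=
    memLp_mulVec (hv.memLp_two k) _
  have hcross (k l : ℕ) :
      crossMoment P (w k) (fun ω => -(L (θ l) * dropMat (θ l)) *ᵥ v l ω) = 0 := by
    rw [crossMoment_eq_zero_comm, crossMoment_mulVec_left (hv.memLp_two l) (hw.memLp_two k),
      crossMoment_eq_zero_comm.1 (hwv k l), Matrix.mul_zero]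
  refine (crossMoment_add_add_of_eq_zero (hw.memLp_two k) (hGv k) (hw.memLp_two l) (hGv l)
    (hcross k l) (hcross l k)).trans ?_
  rw [crossMoment_mulVec_mulVec (hv.memLp_two k) (hv.memLp_two l), hw.crossMoment_eq,
    hv.crossMoment_eq]
  split_ifs with hkl
  · subst hkl
    simp only [noiseMat, Matrix.neg_mul, Matrix.transpose_neg, Matrix.mul_neg, neg_neg]
  · rw [Matrix.mul_zero, Matrix.zero_mul, add_zero]

namespace IsPacketDropModel

variable {A : Matrix (Fin n) (Fin n) ℝ} {C : Matrix (Fin m) (Fin n) ℝ} {p q : Fin m → ℝ}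
  {xbar : Fin n → ℝ} {Pi0 : Matrix (Fin n) (Fin n) ℝ}
  {x₀ : Ω → Fin n → ℝ} {γ : Fin m → ℕ → Ω → Bool}
  (hmodel : IsPacketDropModel P Q R p q xbar Pi0 x₀ w v γ)
include hmodel

theorem crossMoment_process_measurement (k l : ℕ) : crossMoment P (w k) (v l) = 0 := by
  have hind : IndepFun (w k) (v l) P :=
    hmodel.indep_noise.comp (φ := fun u : ℕ → Fin n → ℝ => u k)
      (ψ := fun u : ℕ → Fin m → ℝ => u l) (by fun_prop) (by fun_prop)
  exact crossMoment_eq_zero_of_indepFun hind (hmodel.noise_w.memLp_two k)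
    (hmodel.noise_v.memLp_two l) (hmodel.noise_v.mean l)

variable [IsProbabilityMeasure P]

theorem memLp_initError (z₀ : Fin n → ℝ) : MemLp (fun ω => x₀ ω - z₀) 2 P :=
  (MemLp.of_eval hmodel.memLp_init).sub (memLp_const z₀)

theorem posSemidef_initErrMoment (z₀ : Fin n → ℝ) : (initErrMoment P x₀ z₀).PosSemidef :=
  posSemidef_crossMoment_self (hmodel.memLp_initError z₀)

theorem posDef_initErrMoment (hPi0 : Pi0.PosDef) (z₀ : Fin n → ℝ) :
    (initErrMoment P x₀ z₀).PosDef := by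
  have hbias : MemLp (fun _ : Ω => xbar - z₀) 2 P := memLp_const _
  have hdev := hmodel.memLp_initError xbar
  have hmean (a : Fin n) : ∫ ω, (x₀ ω - xbar) a ∂P = 0 := by
    simp only [Pi.sub_apply]
    rw [integral_sub ((hmodel.memLp_init a).integrable one_le_two) (integrable_const _),
      hmodel.mean_init, integral_const, probReal_univ, one_smul, sub_self]
  have hcross : crossMoment P (fun _ : Ω => xbar - z₀) (fun ω => x₀ ω - xbar) = 0 :=
    crossMoment_eq_zero_of_indepFun (indepFun_const_left _ _) hbias hdev hmean
  have hcov : crossMoment P (fun ω => x₀ ω - xbar) (fun ω => x₀ ω - xbar) = Pi0 :=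
    Matrix.ext hmodel.cov_init
  have hsplit : (fun ω => x₀ ω - z₀) = (fun _ => xbar - z₀) + fun ω => x₀ ω - xbar := by
    funext ω
    exact (sub_add_sub_cancel' xbar z₀ (x₀ ω)).symm
  rw [initErrMoment, hsplit, crossMoment_add_add_of_eq_zero hbias hdev hbias hdev hcross hcross,
    hcov, add_comm]
  exact hPi0.add_posSemidef (posSemidef_crossMoment_self hbias)

theorem crossMoment_initError_errNoise (L : Mode m → Matrix (Fin n) (Fin m) ℝ) (z₀ : Fin n → ℝ)
    (θ : ℕ → Mode m) (l : ℕ) :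
    crossMoment P (fun ω => x₀ ω - z₀)
      (fun ω => errNoise L θ (fun k => w k ω) (fun k => v k ω) l) = 0 := by
  have he := hmodel.memLp_initError z₀
  have hw := hmodel.noise_w.memLp_two l
  have hv := hmodel.noise_v.memLp_two l
  have hindw : IndepFun (fun ω => x₀ ω - z₀) (w l) P :=
    hmodel.indep_init.comp (φ := fun x => x - z₀)
      (ψ := fun u : (ℕ → Fin n → ℝ) × (ℕ → Fin m → ℝ) => u.1 l) (by fun_prop) (by fun_prop)
  have hindv : IndepFun (fun ω => x₀ ω - z₀) (v l) P :=
    hmodel.indep_init.comp (φ := fun x => x - z₀)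
      (ψ := fun u : (ℕ → Fin n → ℝ) × (ℕ → Fin m → ℝ) => u.2 l) (by fun_prop) (by fun_prop)
  have hew := crossMoment_eq_zero_of_indepFun hindw he hw (hmodel.noise_w.mean l)
  have hev := crossMoment_eq_zero_of_indepFun hindv he hv (hmodel.noise_v.mean l)
  rw [crossMoment_eq_zero_comm]
  refine (crossMoment_add_left hw (memLp_mulVec hv _) he).trans ?_
  rw [crossMoment_mulVec_left hv he, crossMoment_eq_zero_comm.1 hew,
    crossMoment_eq_zero_comm.1 hev, Matrix.mul_zero, add_zero]

theorem memLp_estError (L : Mode m → Matrix (Fin n) (Fin m) ℝ) (z₀ : Fin n → ℝ) (θ : ℕ → Mode m)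
    (k : ℕ) :
    MemLp (fun ω => estError A C L θ (x₀ ω - z₀) (fun l => w l ω) (fun l => v l ω) k) 2 P :=
  memLp_drivenState _ (hmodel.memLp_initError z₀)
    (memLp_errNoise L θ hmodel.noise_w hmodel.noise_v) k

theorem crossMoment_estError_self (L : Mode m → Matrix (Fin n) (Fin m) ℝ) (z₀ : Fin n → ℝ)
    (θ : ℕ → Mode m) (k : ℕ) :
    crossMoment P
        (fun ω => estError A C L θ (x₀ ω - z₀) (fun l => w l ω) (fun l => v l ω) k)
        (fun ω => estError A C L θ (x₀ ω - z₀) (fun l => w l ω) (fun l => v l ω) k) =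
      stateCov (fun l => errMat A C L (θ l)) (fun l => noiseMat Q R L (θ l))
        (initErrMoment P x₀ z₀) k :=
  crossMoment_drivenState_self (hmodel.memLp_initError z₀)
    (memLp_errNoise L θ hmodel.noise_w hmodel.noise_v)
    (hmodel.crossMoment_initError_errNoise L z₀ θ)
    (crossMoment_errNoise L θ hmodel.noise_w hmodel.noise_v
      hmodel.crossMoment_process_measurement) k

theorem trace_stateCov_nonneg (L : Mode m → Matrix (Fin n) (Fin m) ℝ) (z₀ : Fin n → ℝ)
    (θ : ℕ → Mode m) (k : ℕ) :
    0 ≤ (stateCov (fun l => errMat A C L (θ l)) (fun l => noiseMat Q R L (θ l))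
      (initErrMoment P x₀ z₀) k).trace := by
  rw [← hmodel.crossMoment_estError_self]
  exact (posSemidef_crossMoment_self (hmodel.memLp_estError L z₀ θ k)).trace_nonneg

-- By independence of the channels and the noises, the noises may be averaged out first, along a
-- fixed path of the mode.
theorem cost_eq_lintegral_stateCov (L : Mode m → Matrix (Fin n) (Fin m) ℝ) (z₀ : Fin n → ℝ)
    (k : ℕ) :
    cost P A C x₀ w v γ L z₀ k = ∫⁻ ω, ENNReal.ofReal (stateCov
      (fun l => errMat A C L fun i => γ i l ω) (fun l => noiseMat Q R L fun i => γ i l ω)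
      (initErrMoment P x₀ z₀) k).trace ∂P := by
  have hγ : Measurable fun ω i k => γ i k ω :=
    measurable_pi_lambda _ fun i => measurable_pi_lambda _ fun k => hmodel.measurable_channel i k
  have hnoise : Measurable fun ω => (x₀ ω, (fun k => w k ω), (fun k => v k ω)) :=
    hmodel.measurable_init.prodMk ((measurable_pi_lambda _ hmodel.noise_w.measurable).prodMk
      (measurable_pi_lambda _ hmodel.noise_v.measurable))
  let sqNorm : (Fin n → ℝ) → ℝ≥0∞ := fun e => ENNReal.ofReal (‖WithLp.toLp 2 e‖ ^ 2)
  have hsqNorm : Measurable sqNorm := by fun_prop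
  calc cost P A C x₀ w v γ L z₀ k
      = ∫⁻ ω, sqNorm (estError A C L (fun l i => γ i l ω) (x₀ ω - z₀)
          (fun l => w l ω) (fun l => v l ω) k) ∂P := by
        simp only [cost, state_sub_estimate, sqNorm]
    _ = ∫⁻ ω, ∫⁻ ω', sqNorm (estError A C L (fun l i => γ i l ω) (x₀ ω' - z₀)
          (fun l => w l ω') (fun l => v l ω') k) ∂P ∂P :=
        lintegral_comp_prodMk_of_indepFun hmodel.indep_channels_noise hγ hnoise
          (hsqNorm.comp (measurable_estError A C L z₀ k))
    _ = _ := lintegral_congr fun ω => by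
        rw [← hmodel.crossMoment_estError_self L z₀ fun l i => γ i l ω]
        exact lintegral_norm_sq_eq_trace_crossMoment (hmodel.memLp_estError L z₀ _ k)

theorem cost_eq (hp : ∀ i, 0 < p i ∧ p i < 1) (hq : ∀ i, 0 < q i ∧ q i < 1)
    (L : Mode m → Matrix (Fin n) (Fin m) ℝ) (z₀ : Fin n → ℝ) :
    cost P A C x₀ w v γ L z₀ = fun k => ENNReal.ofReal (totalTrace (Mode m) (Fin n)
      (errCov A C Q R p q L (fun j => P.real ((fun ω i => γ i 0 ω) ⁻¹' {j}))
        (initErrMoment P x₀ z₀) k)) := by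
  have hT := isPositiveChain_mode hp hq
  have hM : IsMarkovChain P (fun k ω i => γ i k ω) (modeTPM p q) :=
    isMarkovChain_pi (fun l i j => (tpm_pos (hp l) (hq l) i j).le) hmodel.indep_channels
      hmodel.markov
  have hθ (k : ℕ) : Measurable fun ω => (fun i => γ i k ω : Mode m) :=
    measurable_pi_lambda _ fun i => hmodel.measurable_channel i k
  funext k
  have hint : Integrable (fun ω => (stateCov (fun l => errMat A C L fun i => γ i l ω)
      (fun l => noiseMat Q R L fun i => γ i l ω) (initErrMoment P x₀ z₀) k).trace) P :=
    integrable_stateCov hθ (errMat A C L) (noiseMat Q R L) _ k (Matrix.traceLinearMap (Fin n) ℝ ℝ)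
  rw [hmodel.cost_eq_lintegral_stateCov, ← ofReal_integral_eq_lintegral_ofReal hint
    (.of_forall fun ω => hmodel.trace_stateCov_nonneg L z₀ _ k)]
  exact congrArg ENNReal.ofReal (hM.integral_trace_stateCov (fun i j => (hT.pos i j).le) hθ _ _ _ k)

end IsPacketDropModel

end Cost

end PacketDrop

theorem theorem1 {n m : ℕ}
    (A : Matrix (Fin n) (Fin n) ℝ) (C : Matrix (Fin m) (Fin n) ℝ)
    (Q : Matrix (Fin n) (Fin n) ℝ) (hQ : Q.PosSemidef)
    (R : Matrix (Fin m) (Fin m) ℝ) (hR : R.PosDef) (hRdiag : R.IsDiag)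
    (p q : Fin m → ℝ) (hp : ∀ i, 0 < p i ∧ p i < 1) (hq : ∀ i, 0 < q i ∧ q i < 1)
    {Ω : Type*} [MeasurableSpace Ω] (P : Measure Ω) [IsProbabilityMeasure P]
    (xbar : Fin n → ℝ) (Pi0 : Matrix (Fin n) (Fin n) ℝ)
    (x₀ : Ω → Fin n → ℝ) (w : ℕ → Ω → Fin n → ℝ) (v : ℕ → Ω → Fin m → ℝ)
    (γ : Fin m → ℕ → Ω → Bool)
    (hmodel : PacketDrop.IsPacketDropModel P Q R p q xbar Pi0 x₀ w v γ)
    (Y : PacketDrop.Mode m → Matrix (Fin n) (Fin n) ℝ)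
    (hY : PacketDrop.IsMSStabilizingSolution A C Q R p q Y) :
    -- the gains `K(Y)` achieve the stationary cost `∑ i, tr (Y i)`, from every initial estimate
    (∀ z₀ : Fin n → ℝ,
      Tendsto (PacketDrop.cost P A C x₀ w v γ (PacketDrop.kalmanGain A C R p q Y) z₀) atTop
        (𝓝 (ENNReal.ofReal (∑ i, (Y i).trace)))) ∧
    -- no mean-square stable estimator does better, from any initial estimate
    (∀ L : PacketDrop.Mode m → Matrix (Fin n) (Fin m) ℝ, PacketDrop.IsMSStable A C p q L →
      ∀ z₀ : Fin n → ℝ, ENNReal.ofReal (∑ i, (Y i).trace) ≤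
        liminf (PacketDrop.cost P A C x₀ w v γ L z₀) atTop) ∧
    -- if the initial covariance is nondegenerate, then no gains at all do better
    (Pi0.PosDef → ∀ (L : PacketDrop.Mode m → Matrix (Fin n) (Fin m) ℝ) (z₀ : Fin n → ℝ),
      ENNReal.ofReal (∑ i, (Y i).trace) ≤
        liminf (PacketDrop.cost P A C x₀ w v γ L z₀) atTop) := by
  have hT := PacketDrop.isPositiveChain_mode hp hq
  have hπ : (fun j => P.real ((fun ω i => γ i 0 ω) ⁻¹' {j})) ∈
      stdSimplex ℝ (PacketDrop.Mode m) :=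
    PacketDrop.measureReal_preimage_mem_stdSimplex
      (measurable_pi_lambda _ fun i => hmodel.measurable_channel i 0)
  have hS (z₀ : Fin n → ℝ) := (hmodel.posSemidef_initErrMoment z₀).nonneg
  simp only [hmodel.cost_eq (A := A) (C := C) hp hq, ← PacketDrop.totalTrace_apply]
  refine ⟨fun z₀ => ?_, fun L hL z₀ => ?_, fun hPi0 L z₀ => ?_⟩
  · exact (ENNReal.continuous_ofReal.tendsto _).comp
      (hY.tendsto_totalTrace_errCov hT hπ hQ hR hRdiag (hS z₀))
  · have hdecay := hT.isDecaying_jumpOp (PacketDrop.isMSStable_iff.1 hL)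
    exact PacketDrop.ofReal_le_liminf_ofReal fun r hr =>
      hY.eventually_le_totalTrace_errCov hT hπ hQ hR hdecay (hS z₀) hr
  · exact PacketDrop.ofReal_le_liminf_ofReal fun r hr =>
      hY.eventually_le_totalTrace_errCov_of_posDef hT hπ hQ hR
        (hmodel.posDef_initErrMoment hPi0 z₀) hr
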